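/- Let $H=D^2\times S^1$ be a solid torus with boundary $T=S^1\times S^1$, let $\beta=S^1\times\{1\}$ (a meridian of $H$) and $\alpha=\{1\}\times S^1$ (a longitude), and let $A\subset H$ be a properly embedded arc with endpoints $P_1,P_2\in T$ that, together with an arc of $T$, bounds a disc $D\subset H$ disjoint from $\alpha\cup\beta$. Let $MCG_2(T)$ be the group of isotopy classes of orientation-preserving homeomorphisms of $T$ that preserve the set $\{P_1,P_2\}$ (isotopies through such homeomorphisms; products are compositions, the right factor acting first), and let $t_\alpha,t_\beta\in MCG_2(T)$ be the classes of the right-handed Dehn twists around $\alpha,\beta$ (supported away from the punctures), where $T$ is oriented so that $t_\alpha,t_\beta$ act on $H_1(T)$, in the basis $(\beta,\alpha)$, by $\begin{pmatrix}1&0\\1&1\end{pmatrix}$ and $\begin{pmatrix}1&-1\\0&1\end{pmatrix}$. Let $(H',A')$ be a second copy of $(H,A)$. For a homeomorphism $\psi$ with class in $MCG_2(T)$, glue each point $x\in\partial H'=T$ to $\psi(x)\in T=\partial H$; this gives a closed 3-manifold $M_\psi=H\cup_\psi H'$ and a knot $K_\psi=A\cup A'$ in it. A class in $MCG_2(T)$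 represents the trivial knot in a 3-manifold $M$ if, for every homeomorphism $\psi$ in the class, there is a homeomorphism $M_\psi\to M$ (not required to preserve an orientation) taking $K_\psi$ to a trivial knot, that is, to a knot that bounds a tamely embedded disc. For coprime $p>q>0$ let $L(p,q)$ be the quotient of $S^3\subset\mathbb C^2$ by the action $\zeta\cdot(z,w)=(\zeta z,\zeta^q w)$ of the $p$-th roots of unity $\zeta$. Then: (i) the trivial knot in $S^3$ is represented by $t_\beta t_\alpha t_\beta$; (ii) the trivial knot in $S^1\times S^2$ is represented by the identity; (iii) if $p,q$ are integers with $0<q<p$ and $\gcd(p,q)=1$, and if $a_1,\dots,a_m$ are positive integers with $$\frac pq=[a_1,\dots,a_m]=a_1+\cfrac{1}{a_2+\cfrac{1}{\ddots+\cfrac1{a_m}}},$$ then the trivial knot in the lens space $L(p,q)$ is represented by $$\psi_{p,q}=\begin{cases}t_\alpha^{a_1}t_\beta^{-a_2}t_\alpha^{a_3}\cdots t_\alpha^{a_m}&\text{if } m \text{ is odd},\\ t_\alpha^{a_1}t_\beta^{-a_2}t_\alpha^{a_3}\cdots t_\beta^{-a_m}\,t_\beta t_\alpha t_\beta&\text{if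 } m\text{ is even}.\end{cases}$$ -/

import Mathlib

open scoped unitInterval MatrixGroups

noncomputable section

namespace OneOneKnot

/-! ### The torus, the solid torus, the trivial arc and the punctures -/

/-- The torus `T = S¹ × S¹`. The first factor is the meridian direction of the solid torus below,
the second factor is the longitude direction. The curve `β` is the meridian `S¹ × {1}` and the
curve `α` is the longitude `{1} × S¹`. -/
abbrev Torus : Type := Circle × Circle

/-- The solid torus `H = D² × S¹`. -/
abbrev SolidTorus : Type := Metric.closedBall (0 : ℂ) 1 × Circle

/-- The identification of the torus with the boundary of the solid torus. -/
def bdry (x : Torus) : SolidTorus :=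
  (⟨(x.1 : ℂ), by simp [Circle.norm_coe]⟩, x.2)

/-- The point `-3/5 + 4i/5` of the unit circle. -/
def dir : Circle := ⟨(-3 / 5 : ℝ) + (4 / 5 : ℝ) * Complex.I, by
  change _ ∈ Metric.sphere (0 : ℂ) 1
  rw [mem_sphere_zero_iff_norm, ← sq_eq_sq₀ (norm_nonneg _) zero_le_one,
    ← Complex.normSq_eq_norm_sq, Complex.normSq_add_mul_I]
  norm_num⟩

theorem dir_re : (dir : ℂ).re = -3 / 5 := by
  change (((-3 / 5 : ℝ) : ℂ) + ((4 / 5 : ℝ) : ℂ) * Complex.I).re = _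
  rw [Complex.add_re, Complex.ofReal_re, Complex.re_ofReal_mul, Complex.I_re, mul_zero, add_zero]

theorem continuous_coe : Continuous ((↑) : Circle → ℂ) := continuous_subtype_val

/-- The two punctures `P₁, P₂` of the torus. They lie off the curves `α` and `β`. The meridian
`γ = S¹ × {-1}` separates them from each other in the annulus `T - β`. -/
def punctures : Set Torus := {(-1, dir), (-1, dir⁻¹)}

/-- The trivial arc `A` in `H`, a properly embedded arc with endpoints `P₁, P₂`: it runs radially
from `P₁` to half depth, then parallel to the longitude, then radially back to `P₂`. Together with
the segment of the longitude `{-1} × S¹` between `P₁` and `P₂` that misses `β`, it bounds the disc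
`D = {(-s, v) | 1/2 ≤ s ≤ 1, Re v ≤ -3/5}`, which is disjoint from `α` and `β`. -/
def arc : Set SolidTorus :=
  {x | (∃ s : ℝ, 1 / 2 ≤ s ∧ s ≤ 1 ∧ (x.1 : ℂ) = -(s : ℂ)) ∧ (x.2 : ℂ).re = -3 / 5} ∪
  {x | (x.1 : ℂ) = -(1 / 2) ∧ (x.2 : ℂ).re ≤ -3 / 5}

/-! ### The mapping class group of the twice punctured torus -/

/-- The linear self-map of the torus `ℝ² / ℤ²` given by an integral matrix. -/
def linearMap (M : SL(2, ℤ)) : C(Torus, Torus) where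
  toFun x := (x.1 ^ (M.1 0 0) * x.2 ^ (M.1 0 1), x.1 ^ (M.1 1 0) * x.2 ^ (M.1 1 1))
  continuous_toFun := by fun_prop

theorem linearMap_one : linearMap 1 = ContinuousMap.id Torus := by
  ext x <;> simp [linearMap]

theorem linearMap_mul (M N : SL(2, ℤ)) :
    linearMap (M * N) = (linearMap M).comp (linearMap N) := by
  apply ContinuousMap.ext
  intro x
  apply Prod.ext <;>
  · simp only [linearMap, ContinuousMap.coe_mk, ContinuousMap.comp_apply, Matrix.SpecialLinearGroup.coe_mul,
      Matrix.mul_apply, Fin.sum_univ_two, mul_zpow, zpow_add, ← zpow_mul]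
    simp only [mul_comm (M.1 _ _)]
    simp only [mul_comm, mul_left_comm, mul_assoc]

/-- The underlying continuous map of a self-homeomorphism of the torus. -/
def toMap (h : Torus ≃ₜ Torus) : C(Torus, Torus) := ⟨h, h.continuous⟩

/-- A self-homeomorphism of the torus preserves the orientation if and only if the automorphism
of `H₁(T) = ℤ²` that it induces has determinant `1`, that is, if and only if it is homotopic to a
linear map of determinant `1`. -/
def OrientationPreserving (h : Torus ≃ₜ Torus) : Prop :=
  ∃ M : SL(2, ℤ), (toMap h).Homotopic (linearMap M)

theorem OrientationPreserving.mul {f g : Torus ≃ₜ Torus} (hf : OrientationPreserving f)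
    (hg : OrientationPreserving g) : OrientationPreserving (f * g) := by
  obtain ⟨M, hM⟩ := hf
  obtain ⟨N, hN⟩ := hg
  exact ⟨M * N, by rw [linearMap_mul]; exact hM.comp hN⟩

theorem OrientationPreserving.one : OrientationPreserving 1 :=
  ⟨1, by rw [linearMap_one]; exact ContinuousMap.Homotopic.refl _⟩

theorem OrientationPreserving.inv {f : Torus ≃ₜ Torus} (hf : OrientationPreserving f) :
    OrientationPreserving f⁻¹ := by
  obtain ⟨M, hM⟩ := hf
  refine ⟨M⁻¹, ?_⟩
  have h1 := ((ContinuousMap.Homotopic.refl (linearMap M⁻¹)).comp hM).comp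
    (ContinuousMap.Homotopic.refl (toMap f⁻¹))
  have e1 : ((linearMap M⁻¹).comp (toMap f)).comp (toMap f⁻¹) = linearMap M⁻¹ := by
    apply ContinuousMap.ext
    intro x
    change linearMap M⁻¹ ((f * f⁻¹) x) = _
    rw [mul_inv_cancel]
    rfl
  rw [e1, ← linearMap_mul, inv_mul_cancel, linearMap_one] at h1
  exact h1.symm

/-- The group of orientation-preserving self-homeomorphisms of the torus that map the set of
punctures onto itself. The product is composition, `(f * g) x = f (g x)`. -/
def PuncturedHomeo : Subgroup (Torus ≃ₜ Torus) where
  carrier := {h | OrientationPreserving h ∧ h '' punctures = punctures}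
  mul_mem' {f g} hf hg := ⟨hf.1.mul hg.1, by
    change (f ∘ g) '' _ = _
    rw [Set.image_comp, hg.2, hf.2]⟩
  one_mem' := ⟨OrientationPreserving.one, Set.image_id _⟩
  inv_mem' {f} hf := ⟨hf.1.inv, by
    conv_lhs => rw [← hf.2]
    rw [← Set.image_comp]
    change (⇑(f⁻¹ * f)) '' _ = _
    rw [inv_mul_cancel]
    exact Set.image_id _⟩

/-- Isotopy of homeomorphisms of the punctured torus, relative to the set of punctures. -/
def Isotopic (f g : PuncturedHomeo) : Prop :=
  ∃ F : I → PuncturedHomeo,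
    Continuous (fun q : I × Torus => (F q.1 : Torus ≃ₜ Torus) q.2) ∧ F 0 = f ∧ F 1 = g

/-- The homeomorphisms that are isotopic to the identity. -/
def isotopicToOne : Subgroup PuncturedHomeo where
  carrier := {f | Isotopic 1 f}
  mul_mem' {f g} hf hg := by
    obtain ⟨F, hF, hF0, hF1⟩ := hf
    obtain ⟨G, hG, hG0, hG1⟩ := hg
    exact ⟨fun t => F t * G t, hF.comp (continuous_fst.prodMk hG), by simp [hF0, hG0],
      by simp [hF1, hG1]⟩
  one_mem' := ⟨fun _ => 1, continuous_snd, rfl, rfl⟩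
  inv_mem' {f} hf := by
    obtain ⟨F, hF, hF0, hF1⟩ := hf
    refine ⟨fun t => F (unitInterval.symm t) * f⁻¹, ?_, by simp [hF1], by simp [hF0]⟩
    exact hF.comp ((unitInterval.continuous_symm.comp continuous_fst).prodMk
      ((f⁻¹ : PuncturedHomeo).1.continuous.comp continuous_snd))

instance : isotopicToOne.Normal where
  conj_mem f hf g := by
    obtain ⟨F, hF, hF0, hF1⟩ := hf
    refine ⟨fun t => g * F t * g⁻¹, ?_, by simp [hF0], by simp [hF1]⟩
    exact g.1.continuous.comp (hF.comp (continuous_fst.prodMk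
      ((g⁻¹ : PuncturedHomeo).1.continuous.comp continuous_snd)))

/-- The mapping class group `MCG₂(T)` of the twice punctured torus: the group of isotopy classes
of orientation-preserving homeomorphisms of the torus that preserve the set of punctures. -/
abbrev MCG₂ : Type := PuncturedHomeo ⧸ isotopicToOne

/-- Two homeomorphisms have the same mapping class if and only if they are isotopic. -/
theorem mk_eq_mk_iff (f g : PuncturedHomeo) :
    (QuotientGroup.mk f : MCG₂) = QuotientGroup.mk g ↔ Isotopic f g := by
  rw [QuotientGroup.eq]
  constructor
  · rintro ⟨F, hF, hF0, hF1⟩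
    exact ⟨fun t => f * F t, f.1.continuous.comp hF, by simp [hF0], by simp [hF1]⟩
  · rintro ⟨F, hF, hF0, hF1⟩
    exact ⟨fun t => f⁻¹ * F t, (f⁻¹ : PuncturedHomeo).1.continuous.comp hF, by simp [hF0],
      by simp [hF1]⟩

/-! ### Dehn twists -/

/-- The angle of rotation of a Dehn twist: it is constantly `1` off the right half circle, and it
winds once around the circle along the right half circle, from `-i` to `i`. -/
def twistAngle (u : Circle) : Circle := if 0 ≤ (u : ℂ).re then -u ^ 2 else 1

theorem twistAngle_of_re_eq_zero (u : Circle) (hu : (u : ℂ).re = 0) : -u ^ 2 = 1 := by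
  have h1 : Complex.normSq (u : ℂ) = 1 := Circle.normSq_coe u
  rw [Complex.normSq_apply, hu] at h1
  apply Circle.ext
  apply Complex.ext <;> simp [pow_two, hu]
  linarith

theorem continuous_re : Continuous (fun u : Circle => (u : ℂ).re) :=
  Complex.continuous_re.comp continuous_coe

theorem continuous_twistAngle : Continuous twistAngle := by
  refine Continuous.if_le ?_ continuous_const continuous_const continuous_re ?_
  · exact (continuous_id.pow 2).neg
  · intro u hu
    exact twistAngle_of_re_eq_zero u hu.symm

/-- The twist angle is homotopic to the identity of the circle. -/
theorem exists_homotopy_twistAngle : ∃ F : I × Circle → Circle, Continuous F ∧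
    (∀ u, F (0, u) = u) ∧ ∀ u, F (1, u) = twistAngle u := by
  set e : Circle → ℂ := fun u => -((twistAngle u / u : Circle) : ℂ) with he
  have hec : Continuous e :=
    (continuous_coe.comp (continuous_twistAngle.div' continuous_id)).neg
  have hre : ∀ u, e u ∈ Complex.slitPlane := by
    intro u
    by_cases h : 0 ≤ (u : ℂ).re
    · have h1 : e u = u := by
        have h2 : twistAngle u / u = -u := by
          rw [twistAngle, if_pos h, div_eq_iff_eq_mul, neg_mul, sq]
        simp only [he, h2, Circle.coe_neg, neg_neg]
      rw [h1]
      rw [Complex.mem_slitPlane_iff]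
      rcases h.lt_or_eq with h | h
      · exact Or.inl h
      · right
        intro h2
        exact Circle.coe_ne_zero u (Complex.ext h.symm h2)
    · have h1 : e u = -(starRingEnd ℂ u) := by
        simp [he, twistAngle, if_neg h, ← Circle.coe_inv_eq_conj]
      rw [h1, Complex.mem_slitPlane_iff]
      left
      simpa using h
  have hnorm : ∀ u, ‖e u‖ = 1 := by
    intro u
    simp only [he, norm_neg, Circle.norm_coe]
  refine ⟨fun q => q.2 * Circle.exp (q.1 * (Real.pi + Complex.arg (e q.2))), ?_, ?_, ?_⟩
  · refine continuous_snd.mul (Circle.exp.continuous.comp ?_)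
    refine (continuous_subtype_val.comp continuous_fst).mul (continuous_const.add ?_)
    have h1 : Continuous fun u => Complex.arg (e u) := by
      rw [continuous_iff_continuousAt]
      intro u
      exact (Complex.continuousAt_arg (hre u)).comp hec.continuousAt
    exact h1.comp continuous_snd
  · intro u
    simp
  · intro u
    have h2 : Circle.exp (Real.pi + Complex.arg (e u)) = twistAngle u / u := by
      apply Circle.ext
      have h3 : Complex.exp (Complex.arg (e u) * Complex.I) = e u := by
        have := Complex.norm_mul_exp_arg_mul_I (e u)
        rwa [hnorm, Complex.ofReal_one, one_mul] at this
      rw [Circle.coe_exp]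
      push_cast
      rw [add_mul, Complex.exp_add, Complex.exp_pi_mul_I, h3]
      simp [he]
    simp [h2]

theorem twistAngle_of_neg (u : Circle) (hu : (u : ℂ).re < 0) : twistAngle u = 1 :=
  if_neg (not_le.mpr hu)

theorem twistAngle_dir : twistAngle dir = 1 :=
  twistAngle_of_neg _ (by rw [dir_re]; norm_num)

theorem twistAngle_dir_inv : twistAngle dir⁻¹ = 1 :=
  twistAngle_of_neg _ (by rw [Circle.coe_inv_eq_conj, Complex.conj_re, dir_re]; norm_num)

theorem twistAngle_neg_one : twistAngle (-1) = 1 :=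
  twistAngle_of_neg _ (by simp)

/-- The Dehn twist around the longitude `α = {1} × S¹`, supported in the annulus
`{Re u ≥ 0} × S¹`. -/
def twistα : Torus ≃ₜ Torus where
  toFun x := (x.1, x.2 * twistAngle x.1)
  invFun x := (x.1, x.2 / twistAngle x.1)
  left_inv x := by simp
  right_inv x := by simp
  continuous_toFun := continuous_fst.prodMk
    (continuous_snd.mul (continuous_twistAngle.comp continuous_fst))
  continuous_invFun := continuous_fst.prodMk
    (continuous_snd.div' (continuous_twistAngle.comp continuous_fst))

/-- The Dehn twist around the meridian `β = S¹ × {1}`, supported in the annulus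
`S¹ × {Re v ≥ 0}`. It has the same handedness as `twistα`: in the basis `(β, α)` of `H₁(T)`, the
matrices of `twistα` and of `twistβ` are `!![1, 0; 1, 1]` and `!![1, -1; 0, 1]`. Both twists are
right-handed for the orientation of the torus in which the pair `(α, β)` is positive. -/
def twistβ : Torus ≃ₜ Torus where
  toFun x := (x.1 / twistAngle x.2, x.2)
  invFun x := (x.1 * twistAngle x.2, x.2)
  left_inv x := by simp
  right_inv x := by simp
  continuous_toFun := (continuous_fst.div' (continuous_twistAngle.comp continuous_snd)).prodMk
    continuous_snd
  continuous_invFun := (continuous_fst.mul (continuous_twistAngle.comp continuous_snd)).prodMk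
    continuous_snd

theorem twistα_mem : twistα ∈ PuncturedHomeo := by
  constructor
  · refine ⟨⟨!![1, 0; 1, 1], by simp⟩, ContinuousMap.Homotopic.symm ?_⟩
    obtain ⟨F, hF, hF0, hF1⟩ := exists_homotopy_twistAngle
    refine ⟨⟨⟨fun q => (q.2.1, q.2.2 * F (q.1, q.2.1)), ?_⟩, ?_, ?_⟩⟩
    · exact (continuous_fst.comp continuous_snd).prodMk
        ((continuous_snd.comp continuous_snd).mul
          (hF.comp (continuous_fst.prodMk (continuous_fst.comp continuous_snd))))
    · intro x
      simp [hF0, linearMap, mul_comm]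
    · intro x
      simp [hF1, toMap, twistα]
  · simp [punctures, Set.image_pair, twistα, twistAngle_neg_one]

theorem twistβ_mem : twistβ ∈ PuncturedHomeo := by
  constructor
  · refine ⟨⟨!![1, -1; 0, 1], by simp⟩, ContinuousMap.Homotopic.symm ?_⟩
    obtain ⟨F, hF, hF0, hF1⟩ := exists_homotopy_twistAngle
    refine ⟨⟨⟨fun q => (q.2.1 / F (q.1, q.2.2), q.2.2), ?_⟩, ?_, ?_⟩⟩
    · exact ((continuous_fst.comp continuous_snd).div'
          (hF.comp (continuous_fst.prodMk (continuous_snd.comp continuous_snd)))).prodMk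
          (continuous_snd.comp continuous_snd)
    · intro x
      simp [hF0, linearMap, div_eq_mul_inv]
    · intro x
      simp [hF1, toMap, twistβ]
  · simp [punctures, Set.image_pair, twistβ, twistAngle_dir, twistAngle_dir_inv]

/-- The mapping class `t_α`. -/
def tα : MCG₂ := QuotientGroup.mk ⟨twistα, twistα_mem⟩

/-- The mapping class `t_β`. -/
def tβ : MCG₂ := QuotientGroup.mk ⟨twistβ, twistβ_mem⟩

/-! ### The knot given by a mapping class -/

/-- The gluing relation on the disjoint union of the solid torus `H` (left summand) and a second
copy `H'` of it (right summand): a point `x` of `∂H'` is glued to the point `ψ x` of `∂H`. Here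
`H'` carries the opposite orientation, so that the identity `μ : H → H'` reverses the orientation
and the attaching map is `φ = ψ ∘ μ⁻¹`. -/
inductive GlueRel (ψ : Torus ≃ₜ Torus) : SolidTorus ⊕ SolidTorus → SolidTorus ⊕ SolidTorus → Prop
  | glue (x : Torus) : GlueRel ψ (Sum.inr (bdry x)) (Sum.inl (bdry (ψ x)))

/-- The closed 3-manifold `H ∪_φ H'`, with the quotient topology. -/
abbrev Glued (ψ : Torus ≃ₜ Torus) : Type := Quot (GlueRel ψ)

/-- The knot `K_ψ = A ∪_φ A'` in `H ∪_φ H'`. -/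
def knot (ψ : Torus ≃ₜ Torus) : Set (Glued ψ) :=
  Quot.mk (GlueRel ψ) '' (Sum.inl '' arc ∪ Sum.inr '' arc)

/-- A subset `K` of a 3-manifold `M` is a trivial knot if it bounds a tamely embedded disc, that
is, a disc `e (D² × {0})` with a product neighbourhood `e (ℂ × ℝ)` that is open in `M`. -/
def IsTrivialKnot {M : Type*} [TopologicalSpace M] (K : Set M) : Prop :=
  ∃ e : ℂ × ℝ → M, Topology.IsOpenEmbedding e ∧ e '' (Metric.sphere (0 : ℂ) 1 ×ˢ {(0 : ℝ)}) = K

/-- The mapping class `c` represents the trivial knot in the 3-manifold `M`: for each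
homeomorphism `ψ` in the isotopy class `c` there is a homeomorphism of `H ∪_φ H'` onto `M` that
maps `K_ψ` onto a trivial knot. -/
def RepresentsTrivialKnot (c : MCG₂) (M : Type*) [TopologicalSpace M] : Prop :=
  ∀ ψ : PuncturedHomeo, QuotientGroup.mk ψ = c →
    ∃ e : Glued ψ.1 ≃ₜ M, IsTrivialKnot (e '' knot ψ.1)

/-! ### The ambient spaces -/

/-- The 3-sphere, as the unit sphere of `ℂ²`. -/
abbrev Sphere3 : Type := Metric.sphere (0 : EuclideanSpace ℂ (Fin 2)) 1

/-- The 2-sphere. -/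
abbrev Sphere2 : Type := Metric.sphere (0 : EuclideanSpace ℝ (Fin 3)) 1

/-- The orbit relation of the action of the `p`-th roots of unity on the 3-sphere given by
`ζ · (z, w) = (ζ z, ζ ^ q w)`. -/
def lensRel (p q : ℕ) (x y : Sphere3) : Prop :=
  ∃ ζ : ℂ, ζ ^ p = 1 ∧ y.1 0 = ζ * x.1 0 ∧ y.1 1 = ζ ^ q * x.1 1

/-- The lens space `L(p, q)`, for coprime `p, q` with `p > 0`. -/
abbrev LensSpace (p q : ℕ) : Type := Quot (lensRel p q)

/-! ### Continued fractions -/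

/-- The continued fraction `[a₁, …, aₘ] = a₁ + 1 / (a₂ + 1 / (⋯ + 1 / aₘ))`; the convention
`0⁻¹ = 0` gives `[a₁] = a₁`. -/
def contFrac : List ℕ → ℚ
  | [] => 0
  | a :: l => a + (contFrac l)⁻¹

/-- The product `t_α ^ a₁ * t_β ^ (-a₂) * t_α ^ a₃ * t_β ^ (-a₄) * ⋯`, with one factor for each
of `a₁, …, aₘ`. -/
def altProd : List ℕ → MCG₂
  | [] => 1
  | [a] => tα ^ a
  | a :: b :: l => tα ^ a * tβ ^ (-(b : ℤ)) * altProd l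

end OneOneKnot

end

open scoped unitInterval MatrixGroups

noncomputable section

namespace OneOneKnot

/-! ### Points of the glued manifold -/

/-! Both twists are supported off the region `quadrant`, where both circle coordinates have negative
real part, and this region contains the arc and its disc. A product of twists therefore fixes the
boundary torus pointwise near the disc, so in the glued manifold the disc in H and its copy in H'
fit together along a segment of the torus into one tame disc bounded by the knot
(`FixesQuadrant.isTrivialKnot`). The chart `discChart` makes this explicit.

Two things remain. An arbitrary representative of the class differs from the product of twists by an
isotopy preserving the punctures. Such an isotopy extends over a collar of H to a homeomorphism
preserving the arc, because the arc is radial in the collar (`exists_glued_homeomorph_of_isotopy`).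
The same extension without punctures shows that the ambient manifold depends only on the isotopy
class in the unpunctured torus, where each twist is isotopic to a linear map. The subgroup
`linearPairs` carries both facts from the two twists to all words in them, and
`representsTrivialKnot_of_mem_linearPairs` reduces the theorem to identifying the manifold glued by
a matrix of determinant one.

If the first column of the matrix is (q, p) with p > 0, this manifold is L(p, q): the maximum norm
sphere in ℂ × ℂ splits into two solid tori, and `lensCover` maps them onto H and H' by monomials in
the coordinates that are invariant under the p-th roots of unity and separate their orbits
(`nonempty_glued_linearHomeo_homeomorph`). The 3-sphere is the case (0, 1). The identity matrix
glues hemispheres times circles to S¹ × S². For a continued fraction, (q, p) is the first or the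
second column of the word's matrix according to the parity of the length (`altMat_column`); for even
length the factor `matS` moves the second column into first place. -/

theorem bdry_injective : Function.Injective bdry := by
  intro x y h
  have h1 := congrArg (fun a : SolidTorus => (a.1 : ℂ)) h
  have h2 := congrArg (fun a : SolidTorus => a.2) h
  exact Prod.ext (Circle.ext h1) h2

theorem mem_range_bdry_iff (a : SolidTorus) : (∃ x, a = bdry x) ↔ ‖(a.1 : ℂ)‖ = 1 := by
  constructor
  · rintro ⟨x, rfl⟩
    exact Circle.norm_coe x.1
  · intro h
    refine ⟨(⟨a.1, mem_sphere_zero_iff_norm.2 h⟩, a.2), ?_⟩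
    exact Prod.ext (Subtype.ext rfl) rfl

open Classical in
/-- The representative of a point of the glued manifold that lies in `H` whenever possible. -/
def normalForm (ψ : Torus ≃ₜ Torus) : SolidTorus ⊕ SolidTorus → SolidTorus ⊕ SolidTorus
  | Sum.inl a => Sum.inl a
  | Sum.inr b => if h : ∃ x, b = bdry x then Sum.inl (bdry (ψ h.choose)) else Sum.inr b

theorem normalForm_inr_bdry (ψ : Torus ≃ₜ Torus) (x : Torus) :
    normalForm ψ (Sum.inr (bdry x)) = Sum.inl (bdry (ψ x)) := by
  have h : ∃ y, bdry x = bdry y := ⟨x, rfl⟩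
  rw [normalForm, dif_pos h, ← bdry_injective h.choose_spec]

theorem normalForm_inr_of_not (ψ : Torus ≃ₜ Torus) {b : SolidTorus} (h : ¬ ∃ x, b = bdry x) :
    normalForm ψ (Sum.inr b) = Sum.inr b := dif_neg h

/-- The normal form is constant along the gluing relation, so it descends to the quotient. This
decides equality of points without computing the generated equivalence relation. -/
theorem normalForm_eq_of_mk_eq {ψ : Torus ≃ₜ Torus} {s t : SolidTorus ⊕ SolidTorus}
    (h : Quot.mk (GlueRel ψ) s = Quot.mk (GlueRel ψ) t) : normalForm ψ s = normalForm ψ t := by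
  refine congrArg (Quot.lift (normalForm ψ) ?_) h
  rintro _ _ ⟨x⟩
  exact normalForm_inr_bdry ψ x

theorem mk_inr_bdry (ψ : Torus ≃ₜ Torus) (x : Torus) :
    Quot.mk (GlueRel ψ) (Sum.inr (bdry x)) = Quot.mk (GlueRel ψ) (Sum.inl (bdry (ψ x))) :=
  Quot.sound ⟨x⟩

theorem mk_inl_eq_mk_inl {ψ : Torus ≃ₜ Torus} {a b : SolidTorus} :
    Quot.mk (GlueRel ψ) (Sum.inl a) = Quot.mk (GlueRel ψ) (Sum.inl b) ↔ a = b :=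
  ⟨fun h => Sum.inl_injective (normalForm_eq_of_mk_eq h), fun h => by rw [h]⟩

theorem mk_inr_eq_mk_inl {ψ : Torus ≃ₜ Torus} {a b : SolidTorus} :
    Quot.mk (GlueRel ψ) (Sum.inr a) = Quot.mk (GlueRel ψ) (Sum.inl b) ↔
      ∃ x, a = bdry x ∧ b = bdry (ψ x) := by
  constructor
  · intro h
    have h1 := normalForm_eq_of_mk_eq h
    by_cases ha : ∃ x, a = bdry x
    · obtain ⟨x, rfl⟩ := ha
      rw [normalForm_inr_bdry] at h1
      exact ⟨x, rfl, (Sum.inl_injective h1).symm⟩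
    · rw [normalForm_inr_of_not ψ ha] at h1
      cases h1
  · rintro ⟨x, rfl, rfl⟩
    exact mk_inr_bdry ψ x

theorem mk_inr_eq_mk_inr {ψ : Torus ≃ₜ Torus} {a b : SolidTorus} :
    Quot.mk (GlueRel ψ) (Sum.inr a) = Quot.mk (GlueRel ψ) (Sum.inr b) ↔ a = b := by
  refine ⟨fun h => ?_, fun h => by rw [h]⟩
  have h1 := normalForm_eq_of_mk_eq h
  by_cases ha : ∃ x, a = bdry x <;> by_cases hb : ∃ x, b = bdry x
  · obtain ⟨x, rfl⟩ := ha
    obtain ⟨y, rfl⟩ := hb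
    rw [normalForm_inr_bdry, normalForm_inr_bdry] at h1
    rw [ψ.injective (bdry_injective (Sum.inl_injective h1))]
  · obtain ⟨x, rfl⟩ := ha
    rw [normalForm_inr_bdry, normalForm_inr_of_not ψ hb] at h1
    cases h1
  · obtain ⟨y, rfl⟩ := hb
    rw [normalForm_inr_bdry, normalForm_inr_of_not ψ ha] at h1
    cases h1
  · rw [normalForm_inr_of_not ψ ha, normalForm_inr_of_not ψ hb] at h1
    exact Sum.inr_injective h1

/-! ### Extending an isotopy of the torus over a collar of the solid torus -/

/-- Polar coordinates on the solid torus. -/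
def polar (q : I × Torus) : SolidTorus :=
  (⟨(q.1 : ℝ) * (q.2.1 : ℂ), by
    rw [mem_closedBall_zero_iff, norm_mul, Circle.norm_coe, mul_one, Complex.norm_real,
      Real.norm_of_nonneg q.1.2.1]
    exact q.1.2.2⟩, q.2.2)

theorem continuous_polar : Continuous polar := by
  refine Continuous.prodMk (Continuous.subtype_mk ?_ _) (by fun_prop)
  exact (Complex.continuous_ofReal.comp (continuous_subtype_val.comp continuous_fst)).mul
    (continuous_coe.comp (by fun_prop))

theorem polar_surjective : Function.Surjective polar := by
  rintro ⟨⟨z, hz⟩, v⟩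
  rw [mem_closedBall_zero_iff] at hz
  refine ⟨(⟨‖z‖, norm_nonneg z, hz⟩, (Circle.exp (Complex.arg z), v)), ?_⟩
  refine Prod.ext (Subtype.ext ?_) rfl
  change ((‖z‖ : ℝ) : ℂ) * (Circle.exp (Complex.arg z) : ℂ) = z
  rw [Circle.coe_exp, Complex.norm_mul_exp_arg_mul_I]

theorem isQuotientMap_polar : Topology.IsQuotientMap polar :=
  .of_surjective_continuous polar_surjective continuous_polar

theorem polar_eq_polar_iff {s t : I} {x y : Torus} :
    polar (s, x) = polar (t, y) ↔ s = t ∧ x.2 = y.2 ∧ (s = 0 ∨ x.1 = y.1) := by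
  constructor
  · intro h
    have h1 : ((s : ℝ) : ℂ) * (x.1 : ℂ) = ((t : ℝ) : ℂ) * (y.1 : ℂ) :=
      congrArg (fun a : SolidTorus => (a.1 : ℂ)) h
    have h2 : x.2 = y.2 := congrArg (fun a : SolidTorus => a.2) h
    have h3 : s = t := by
      have := congrArg norm h1
      simp only [norm_mul, Circle.norm_coe, mul_one, Complex.norm_real,
        Real.norm_of_nonneg s.2.1, Real.norm_of_nonneg t.2.1] at this
      exact Subtype.ext this
    subst h3
    refine ⟨rfl, h2, ?_⟩
    by_cases hs : s = 0
    · exact Or.inl hs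
    · refine Or.inr (Circle.ext (mul_left_cancel₀ ?_ h1))
      rw [Complex.ofReal_ne_zero]
      exact fun h => hs (Subtype.ext h)
  · rintro ⟨rfl, h2, h3⟩
    refine Prod.ext (Subtype.ext ?_) h2
    change ((s : ℝ) : ℂ) * (x.1 : ℂ) = ((s : ℝ) : ℂ) * (y.1 : ℂ)
    rcases h3 with rfl | h3
    · simp
    · rw [h3]

theorem polar_one (x : Torus) : polar (1, x) = bdry x :=
  Prod.ext (Subtype.ext (by simp [polar, bdry])) rfl

/-- The time at which an isotopy is applied at a given radius: it is `0` up to half the radius. -/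
def collarTime (s : I) : I := Set.projIcc 0 1 zero_le_one (2 * (s : ℝ) - 1)

theorem continuous_collarTime : Continuous collarTime :=
  continuous_projIcc.comp (by fun_prop)

theorem collarTime_of_le {s : I} (hs : (s : ℝ) ≤ 1 / 2) : collarTime s = 0 :=
  Set.projIcc_of_le_left _ (by linarith)

theorem collarTime_one : collarTime 1 = 1 :=
  Set.projIcc_of_right_le _ (by norm_num)

/-- The self-map of the solid torus that applies a homotopy of the torus along a collar. -/
def collarMap (E : I × Torus → Torus) (a : SolidTorus) : SolidTorus :=
  let q := Function.surjInv polar_surjective a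
  polar (q.1, E (collarTime q.1, q.2))

/-- The arbitrary preimage chosen in `collarMap` does not matter: polar coordinates are ambiguous
only on the core, where the homotopy is still at time 0. -/
theorem collarMap_polar {E : I × Torus → Torus} (hE : ∀ x, E (0, x) = x) (s : I) (x : Torus) :
    collarMap E (polar (s, x)) = polar (s, E (collarTime s, x)) := by
  have h := Function.surjInv_eq polar_surjective (polar (s, x))
  rw [collarMap]
  generalize Function.surjInv polar_surjective (polar (s, x)) = q at h
  obtain ⟨t, y⟩ := q
  obtain ⟨rfl, h2, h3⟩ := polar_eq_polar_iff.1 h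
  rcases h3 with rfl | h3
  · rw [collarTime_of_le (by simp), hE, hE]
    exact polar_eq_polar_iff.2 ⟨rfl, h2, Or.inl rfl⟩
  · rw [Prod.ext h3 h2]

theorem continuous_collarMap {E : I × Torus → Torus} (hE : ∀ x, E (0, x) = x)
    (hc : Continuous E) : Continuous (collarMap E) := by
  rw [isQuotientMap_polar.continuous_iff]
  have h : collarMap E ∘ polar = fun q => polar (q.1, E (collarTime q.1, q.2)) :=
    funext fun q => collarMap_polar hE q.1 q.2
  rw [h]
  exact continuous_polar.comp (continuous_fst.prodMk
    (hc.comp ((continuous_collarTime.comp continuous_fst).prodMk continuous_snd)))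

theorem collarMap_bdry {E : I × Torus → Torus} (hE : ∀ x, E (0, x) = x) (x : Torus) :
    collarMap E (bdry x) = bdry (E (1, x)) := by
  rw [← polar_one, collarMap_polar hE, collarTime_one, polar_one]

theorem collarMap_leftInverse {E E' : I × Torus → Torus} (hE : ∀ x, E (0, x) = x)
    (hE' : ∀ x, E' (0, x) = x) (h : ∀ t x, E' (t, E (t, x)) = x) :
    Function.LeftInverse (collarMap E') (collarMap E) := by
  intro a
  obtain ⟨⟨s, x⟩, rfl⟩ := polar_surjective a
  rw [collarMap_polar hE, collarMap_polar hE', h]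

theorem polar_mem_arc_of_mem_punctures {s : I} (hs : 1 / 2 ≤ (s : ℝ)) {x : Torus}
    (hx : x ∈ punctures) : polar (s, x) ∈ arc := by
  left
  refine ⟨⟨s, hs, s.2.2, ?_⟩, ?_⟩
  · rcases hx with rfl | rfl <;> simp [polar]
  · rcases hx with rfl | rfl
    · exact dir_re
    · change ((dir⁻¹ : Circle) : ℂ).re = _
      rw [Circle.coe_inv_eq_conj, Complex.conj_re, dir_re]

theorem eq_dir_or_of_re {v : Circle} (h : (v : ℂ).re = -3 / 5) : v = dir ∨ v = dir⁻¹ := by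
  have h1 : Complex.normSq (v : ℂ) = 1 := Circle.normSq_coe v
  have h2 : Complex.normSq (dir : ℂ) = 1 := Circle.normSq_coe dir
  rw [Complex.normSq_apply] at h1 h2
  have h3 : (v : ℂ).im = (dir : ℂ).im ∨ (v : ℂ).im = -(dir : ℂ).im := by
    rw [← mul_self_eq_mul_self_iff]
    rw [h] at h1
    rw [dir_re] at h2
    linarith
  rcases h3 with h3 | h3
  · exact Or.inl (Circle.ext (Complex.ext (h.trans dir_re.symm) h3))
  · refine Or.inr (Circle.ext ?_)
    rw [Circle.coe_inv_eq_conj]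
    exact Complex.ext (by rw [Complex.conj_re, h, dir_re]) (by rw [Complex.conj_im, h3])

theorem mem_arc_iff_exists_polar {a : SolidTorus} : a ∈ arc ↔
    (∃ s : I, ∃ x ∈ punctures, 1 / 2 ≤ (s : ℝ) ∧ a = polar (s, x)) ∨
      ((a.1 : ℂ) = -(1 / 2) ∧ (a.2 : ℂ).re ≤ -3 / 5) := by
  constructor
  · rintro (⟨⟨s, h1, h2, h3⟩, h4⟩ | h)
    · refine Or.inl ⟨⟨s, by linarith, h2⟩, (-1, a.2), ?_, h1, ?_⟩
      · rcases eq_dir_or_of_re h4 with h | h <;> simp [punctures, h]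
      · exact Prod.ext (Subtype.ext (by simp [polar, h3])) rfl
    · exact Or.inr h
  · rintro (⟨s, x, hx, hs, rfl⟩ | h)
    · exact polar_mem_arc_of_mem_punctures hs hx
    · exact Or.inr h

/-- The radial legs of the arc are rays over the punctures, which the homotopy maps into the
punctures at every time; the inner piece lies at radius 1/2, where nothing moves. -/
theorem collarMap_mem_arc {E : I × Torus → Torus} (hE : ∀ x, E (0, x) = x)
    (hp : ∀ t, ∀ x ∈ punctures, E (t, x) ∈ punctures) {a : SolidTorus} (ha : a ∈ arc) :
    collarMap E a ∈ arc := by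
  rcases mem_arc_iff_exists_polar.1 ha with ⟨s, x, hx, hs, rfl⟩ | h
  · rw [collarMap_polar hE]
    exact polar_mem_arc_of_mem_punctures hs (hp _ _ hx)
  · obtain ⟨⟨s, x⟩, rfl⟩ := polar_surjective a
    have hs : (s : ℝ) = 1 / 2 := by
      have := congrArg norm h.1
      simpa [polar, norm_mul, Circle.norm_coe, abs_of_nonneg s.2.1] using this
    rwa [collarMap_polar hE, collarTime_of_le hs.le, hE]

/-! ### Isotopic gluing maps give homeomorphic manifolds -/

/-- Self-homeomorphisms of the two solid tori that intertwine two gluing maps. -/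
theorem exists_glued_homeomorph {f g : Torus ≃ₜ Torus} (Φ : SolidTorus ≃ₜ SolidTorus)
    (h : ∀ x, Φ (bdry (f x)) = bdry (g x)) :
    ∃ e : Glued f ≃ₜ Glued g, (∀ a, e (Quot.mk _ (Sum.inl a)) = Quot.mk _ (Sum.inl (Φ a))) ∧
      ∀ a, e (Quot.mk _ (Sum.inr a)) = Quot.mk _ (Sum.inr a) := by
  have h' : ∀ x, Φ.symm (bdry (g x)) = bdry (f x) := fun x => by
    rw [← h, Homeomorph.symm_apply_apply]
  have c1 : Continuous fun s => Quot.mk (GlueRel g) (Sum.map Φ id s) :=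
    continuous_quot_mk.comp (Φ.continuous.sumMap continuous_id)
  have c2 : Continuous fun s => Quot.mk (GlueRel f) (Sum.map Φ.symm id s) :=
    continuous_quot_mk.comp (Φ.symm.continuous.sumMap continuous_id)
  have r1 : ∀ s t, GlueRel f s t →
      Quot.mk (GlueRel g) (Sum.map Φ id s) = Quot.mk (GlueRel g) (Sum.map Φ id t) := by
    rintro _ _ ⟨x⟩
    simp only [Sum.map_inl, Sum.map_inr, id, h]
    exact mk_inr_bdry g x
  have r2 : ∀ s t, GlueRel g s t →
      Quot.mk (GlueRel f) (Sum.map Φ.symm id s) = Quot.mk (GlueRel f) (Sum.map Φ.symm id t) := by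
    rintro _ _ ⟨x⟩
    simp only [Sum.map_inl, Sum.map_inr, id, h']
    exact mk_inr_bdry f x
  refine ⟨⟨⟨Quot.lift _ r1, Quot.lift _ r2, ?_, ?_⟩, continuous_quot_lift r1 c1,
    continuous_quot_lift r2 c2⟩, fun a => rfl, fun a => rfl⟩
  · rintro ⟨a | a⟩ <;> simp
  · rintro ⟨a | a⟩ <;> simp

/-- The track map (t, x) ↦ (t, F t x) is a continuous bijection of a compact Hausdorff space, hence
a homeomorphism. -/
theorem continuous_symm_of_continuous {F : I → Torus ≃ₜ Torus}
    (hF : Continuous fun q : I × Torus => F q.1 q.2) :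
    Continuous fun q : I × Torus => (F q.1).symm q.2 := by
  let e : I × Torus ≃ I × Torus :=
    ⟨fun q => (q.1, F q.1 q.2), fun q => (q.1, (F q.1).symm q.2), fun q => by simp,
      fun q => by simp⟩
  have he : Continuous e := continuous_fst.prodMk hF
  exact continuous_snd.comp he.homeoOfEquivCompactToT2.symm.continuous

/-- The isotopy F t ∘ (F 0)⁻¹ starts at the identity and extends over a collar of H. Its end map
carries the first gluing map to the second, while H' is left fixed. The knot statement is
conditional so that isotopies moving the punctures are covered too. -/
theorem exists_glued_homeomorph_of_isotopy {F : I → Torus ≃ₜ Torus}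
    (hF : Continuous fun q : I × Torus => F q.1 q.2) :
    ∃ e : Glued (F 0) ≃ₜ Glued (F 1),
      (∀ t, F t '' punctures = punctures) → e '' knot (F 0) = knot (F 1) := by
  have hF' := continuous_symm_of_continuous hF
  let E : I × Torus → Torus := fun q => F q.1 ((F 0).symm q.2)
  let E' : I × Torus → Torus := fun q => F 0 ((F q.1).symm q.2)
  have hE : ∀ x, E (0, x) = x := fun x => (F 0).apply_symm_apply x
  have hE' : ∀ x, E' (0, x) = x := fun x => (F 0).apply_symm_apply x
  have cE : Continuous E :=
    hF.comp (continuous_fst.prodMk ((F 0).symm.continuous.comp continuous_snd))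
  have cE' : Continuous E' := (F 0).continuous.comp hF'
  let Φ : SolidTorus ≃ₜ SolidTorus :=
    ⟨⟨collarMap E, collarMap E', collarMap_leftInverse hE hE' fun t x => by simp [E, E'],
      collarMap_leftInverse hE' hE fun t x => by simp [E, E']⟩,
      continuous_collarMap hE cE, continuous_collarMap hE' cE'⟩
  obtain ⟨e, he1, he2⟩ := exists_glued_homeomorph (f := F 0) (g := F 1) Φ fun x => by
    change collarMap E (bdry (F 0 x)) = _
    rw [collarMap_bdry hE]
    simp [E]
  refine ⟨e, fun hp => ?_⟩
  have hm : ∀ t, ∀ x ∈ punctures, F t x ∈ punctures := fun t x hx => by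
    rw [← hp t]
    exact Set.mem_image_of_mem _ hx
  have hm' : ∀ t, ∀ x ∈ punctures, (F t).symm x ∈ punctures := fun t x hx => by
    rw [← hp t] at hx
    obtain ⟨y, hy, rfl⟩ := hx
    rwa [Homeomorph.symm_apply_apply]
  have harc : Φ '' arc = arc := by
    refine Set.Subset.antisymm ?_ fun a ha => ?_
    · rintro _ ⟨a, ha, rfl⟩
      exact collarMap_mem_arc hE (fun t x hx => hm t _ (hm' 0 _ hx)) ha
    · exact ⟨Φ.symm a, collarMap_mem_arc hE' (fun t x hx => hm 0 _ (hm' t _ hx)) ha,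
        Φ.apply_symm_apply a⟩
  simp only [knot, Set.image_union, Set.image_image, he1, he2]
  -- The third occurrence of `arc` is the one in H on the right-hand side.
  nth_rewrite 3 [← harc]
  rw [Set.image_image]

/-! ### The knot of a gluing map that is the identity near the disc is trivial -/

theorem IsTrivialKnot.image {M N : Type*} [TopologicalSpace M] [TopologicalSpace N] {K : Set M}
    (h : IsTrivialKnot K) (e : M ≃ₜ N) : IsTrivialKnot (e '' K) := by
  obtain ⟨c, hc, rfl⟩ := h
  exact ⟨e ∘ c, e.isOpenEmbedding.comp hc, by rw [Set.image_comp]⟩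

/-! ### Slope coordinates on the quadrant and the chart around the disc -/

/-- The point of the left half circle with a given slope. -/
def leftPoint (t : ℝ) : Circle := -Circle.exp (Real.arctan t)

theorem continuous_leftPoint : Continuous leftPoint :=
  (Circle.exp.continuous.comp Real.continuous_arctan).neg

theorem leftPoint_re (t : ℝ) : (leftPoint t : ℂ).re = -(1 / √(1 + t ^ 2)) := by
  rw [leftPoint, Circle.coe_neg, Circle.coe_exp, Complex.neg_re, Complex.exp_ofReal_mul_I_re,
    Real.cos_arctan]

theorem leftPoint_im (t : ℝ) : (leftPoint t : ℂ).im = -(t / √(1 + t ^ 2)) := by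
  rw [leftPoint, Circle.coe_neg, Circle.coe_exp, Complex.neg_im, Complex.exp_ofReal_mul_I_im,
    Real.sin_arctan]

theorem leftPoint_re_neg (t : ℝ) : (leftPoint t : ℂ).re < 0 := by
  rw [leftPoint_re, neg_lt_zero]
  positivity

theorem leftPoint_slope (t : ℝ) : (leftPoint t : ℂ).im / (leftPoint t : ℂ).re = t := by
  rw [leftPoint_re, leftPoint_im, neg_div_neg_eq]
  have : √(1 + t ^ 2) ≠ 0 := by positivity
  field_simp

/-- In the open left half plane, norm and slope determine the point, since √(1 + slope²) = ‖z‖ /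
(-re z). -/
theorem norm_mul_leftPoint {z : ℂ} (hz : z.re < 0) : (‖z‖ : ℂ) * leftPoint (z.im / z.re) = z := by
  have h1 : √(1 + (z.im / z.re) ^ 2) = ‖z‖ / -z.re := by
    rw [Real.sqrt_eq_iff_mul_self_eq (by positivity)
      (div_nonneg (norm_nonneg z) (by linarith))]
    rw [div_mul_div_comm, Complex.norm_mul_self_eq_normSq, Complex.normSq_apply]
    have := hz.ne
    field_simp
  have h2 : ‖z‖ ≠ 0 := norm_ne_zero_iff.2 fun h => by simp [h] at hz
  have h3 := hz.ne
  apply Complex.ext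
  · rw [Complex.re_ofReal_mul, leftPoint_re, h1]
    field_simp
  · rw [Complex.im_ofReal_mul, leftPoint_im, h1]
    field_simp

/-- The part of the solid torus that contains the arc and its disc. -/
def quadrant : Set SolidTorus := {a | (a.1 : ℂ).re < 0 ∧ (a.2 : ℂ).re < 0}

/-- The radius `1 / (1 + |x|)`. -/
def chartRadius (x : ℝ) : I :=
  ⟨1 / (1 + |x|), by positivity, by
    rw [div_le_one (by positivity)]
    linarith [abs_nonneg x]⟩

theorem continuous_chartRadius : Continuous chartRadius := by
  refine Continuous.subtype_mk ?_ _
  exact continuous_const.div (by fun_prop) fun x => by positivity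

theorem chartRadius_pos (x : ℝ) : 0 < (chartRadius x : ℝ) := by
  change 0 < 1 / (1 + |x|)
  positivity

theorem chartRadius_eq_one_iff {x : ℝ} : (chartRadius x : ℝ) = 1 ↔ x = 0 := by
  change 1 / (1 + |x|) = 1 ↔ _
  rw [div_eq_one_iff_eq (by positivity), left_eq_add, abs_eq_zero]

/-- A parametrization of the quadrant, two-to-one off the boundary. -/
def quadrantParam (p : ℝ × ℝ × ℝ) : SolidTorus :=
  -- The slope of `dir` is -4/3, so the second coordinate is ±1 exactly where Re v = -3/5; likewise
  -- the first is ±1 exactly at radius 1/2. This turns the knot into the boundary of a square.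
  polar (chartRadius p.1, (leftPoint p.2.2, leftPoint (4 / 3 * p.2.1)))

theorem continuous_quadrantParam : Continuous quadrantParam := by
  refine continuous_polar.comp ((continuous_chartRadius.comp continuous_fst).prodMk
    ((continuous_leftPoint.comp (by fun_prop)).prodMk (continuous_leftPoint.comp (by fun_prop))))

theorem quadrantParam_coe (p : ℝ × ℝ × ℝ) :
    ((quadrantParam p).1 : ℂ) = (chartRadius p.1 : ℝ) * leftPoint p.2.2 := rfl

theorem quadrantParam_snd (p : ℝ × ℝ × ℝ) :
    (quadrantParam p).2 = leftPoint (4 / 3 * p.2.1) := rfl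

theorem quadrantParam_mem (p : ℝ × ℝ × ℝ) : quadrantParam p ∈ quadrant := by
  refine ⟨?_, leftPoint_re_neg _⟩
  rw [quadrantParam_coe, Complex.re_ofReal_mul]
  exact mul_neg_of_pos_of_neg (chartRadius_pos _) (leftPoint_re_neg _)

theorem norm_quadrantParam (p : ℝ × ℝ × ℝ) :
    ‖((quadrantParam p).1 : ℂ)‖ = chartRadius p.1 := by
  rw [quadrantParam_coe, norm_mul, Circle.norm_coe, mul_one, Complex.norm_real,
    Real.norm_of_nonneg (chartRadius_pos _).le]

/-- The coordinates inverse to `quadrantParam`, with a choice of sign for the first one. -/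
def quadrantCoord (ε : ℝ) (a : SolidTorus) : ℝ × ℝ × ℝ :=
  (ε * (1 / ‖(a.1 : ℂ)‖ - 1), 3 / 4 * ((a.2 : ℂ).im / (a.2 : ℂ).re),
    (a.1 : ℂ).im / (a.1 : ℂ).re)

theorem continuousOn_quadrantCoord (ε : ℝ) : ContinuousOn (quadrantCoord ε) quadrant := by
  have h1 : Continuous fun a : SolidTorus => (a.1 : ℂ) :=
    continuous_subtype_val.comp continuous_fst
  have h2 : Continuous fun a : SolidTorus => (a.2 : ℂ) := continuous_coe.comp continuous_snd
  refine ContinuousOn.prodMk ?_ (ContinuousOn.prodMk ?_ ?_)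
  · refine continuousOn_const.mul ((continuousOn_const.div h1.norm.continuousOn ?_).sub
      continuousOn_const)
    rintro a ⟨ha, -⟩
    exact norm_ne_zero_iff.2 fun h => by simp [h] at ha
  · exact continuousOn_const.mul ((Complex.continuous_im.comp h2).continuousOn.div
      (Complex.continuous_re.comp h2).continuousOn fun a ha => ha.2.ne)
  · exact (Complex.continuous_im.comp h1).continuousOn.div
      (Complex.continuous_re.comp h1).continuousOn fun a ha => ha.1.ne

theorem isOpen_quadrant : IsOpen quadrant :=
  (isOpen_Iio.preimage (Complex.continuous_re.comp
    (continuous_subtype_val.comp continuous_fst))).inter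
    (isOpen_Iio.preimage (Complex.continuous_re.comp (continuous_coe.comp continuous_snd)))

/-- The radius remembers only the absolute value of the first coordinate; ε = -1 recovers it on the
half in H, ε = 1 on the half in H'. -/
theorem quadrantCoord_quadrantParam {ε : ℝ} {p : ℝ × ℝ × ℝ} (h : ε * |p.1| = p.1) :
    quadrantCoord ε (quadrantParam p) = p := by
  refine Prod.ext ?_ (Prod.ext ?_ ?_)
  · change ε * (1 / ‖((quadrantParam p).1 : ℂ)‖ - 1) = p.1
    rw [norm_quadrantParam]
    change ε * (1 / (1 / (1 + |p.1|)) - 1) = p.1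
    rw [one_div_one_div, add_sub_cancel_left, h]
  · change 3 / 4 * (((quadrantParam p).2 : ℂ).im / ((quadrantParam p).2 : ℂ).re) = p.2.1
    rw [quadrantParam_snd, leftPoint_slope]
    ring
  · change ((quadrantParam p).1 : ℂ).im / ((quadrantParam p).1 : ℂ).re = p.2.2
    rw [quadrantParam_coe, Complex.re_ofReal_mul, Complex.im_ofReal_mul,
      mul_div_mul_left _ _ (chartRadius_pos _).ne', leftPoint_slope]

theorem one_le_one_div_norm {a : SolidTorus} (ha : a ∈ quadrant) : 0 ≤ 1 / ‖(a.1 : ℂ)‖ - 1 := by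
  have h1 : 0 < ‖(a.1 : ℂ)‖ := norm_pos_iff.2 fun h => by simpa [h] using ha.1
  rw [sub_nonneg, le_div_iff₀ h1, one_mul]
  exact mem_closedBall_zero_iff.1 a.1.2

theorem quadrantParam_quadrantCoord {ε : ℝ} (hε : |ε| = 1) {a : SolidTorus} (ha : a ∈ quadrant) :
    quadrantParam (quadrantCoord ε a) = a := by
  refine Prod.ext (Subtype.ext ?_) ?_
  · have h : ((chartRadius (quadrantCoord ε a).1 : I) : ℝ) = ‖(a.1 : ℂ)‖ := by
      change 1 / (1 + |ε * (1 / ‖(a.1 : ℂ)‖ - 1)|) = _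
      rw [abs_mul, hε, one_mul, abs_of_nonneg (one_le_one_div_norm ha), add_sub_cancel,
        one_div_one_div]
    rw [quadrantParam_coe, h]
    exact norm_mul_leftPoint ha.1
  · rw [quadrantParam_snd]
    apply Circle.ext
    have h := norm_mul_leftPoint ha.2
    rw [Circle.norm_coe, Complex.ofReal_one, one_mul] at h
    have e : 4 / 3 * (quadrantCoord ε a).2.1 = (a.2 : ℂ).im / (a.2 : ℂ).re := by
      change 4 / 3 * (3 / 4 * ((a.2 : ℂ).im / (a.2 : ℂ).re)) = _
      ring
    rw [e, h]

/-- A self-map of the torus fixes all points near the disc bounded by the arc. -/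
def FixesQuadrant (ψ : Torus ≃ₜ Torus) : Prop :=
  ∀ x : Torus, (x.1 : ℂ).re < 0 → (x.2 : ℂ).re < 0 → ψ x = x

/-- A chart of the glued manifold around the disc bounded by the knot. -/
def discChart (ψ : Torus ≃ₜ Torus) (p : ℝ × ℝ × ℝ) : Glued ψ :=
  if p.1 ≤ 0 then Quot.mk _ (Sum.inl (quadrantParam p)) else Quot.mk _ (Sum.inr (quadrantParam p))

theorem discChart_of_nonpos (ψ : Torus ≃ₜ Torus) {p : ℝ × ℝ × ℝ} (hp : p.1 ≤ 0) :
    discChart ψ p = Quot.mk _ (Sum.inl (quadrantParam p)) := if_pos hp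

theorem quadrantParam_eq_bdry {p : ℝ × ℝ × ℝ} (hp : p.1 = 0) :
    quadrantParam p = bdry (leftPoint p.2.2, leftPoint (4 / 3 * p.2.1)) := by
  rw [quadrantParam, ← polar_one]
  congr 2
  exact Subtype.ext (chartRadius_eq_one_iff.2 hp)

theorem eq_zero_of_quadrantParam_eq_bdry {p : ℝ × ℝ × ℝ} {x : Torus}
    (h : quadrantParam p = bdry x) : p.1 = 0 := by
  rw [← chartRadius_eq_one_iff, ← norm_quadrantParam]
  exact (mem_range_bdry_iff _).1 ⟨x, h⟩

/-- The two halves of the chart agree on their common face because the gluing map is the identity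
there. -/
theorem FixesQuadrant.mk_inr_eq_mk_inl {ψ : Torus ≃ₜ Torus} (hψ : FixesQuadrant ψ)
    {p : ℝ × ℝ × ℝ} (hp : p.1 = 0) :
    Quot.mk (GlueRel ψ) (Sum.inr (quadrantParam p)) =
      Quot.mk (GlueRel ψ) (Sum.inl (quadrantParam p)) := by
  rw [quadrantParam_eq_bdry hp, mk_inr_bdry, hψ _ (leftPoint_re_neg _) (leftPoint_re_neg _)]

theorem FixesQuadrant.discChart_of_nonneg {ψ : Torus ≃ₜ Torus} (hψ : FixesQuadrant ψ)
    {p : ℝ × ℝ × ℝ} (hp : 0 ≤ p.1) :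
    discChart ψ p = Quot.mk _ (Sum.inr (quadrantParam p)) := by
  rcases hp.eq_or_lt with h | h
  · rw [discChart_of_nonpos ψ h.symm.le, hψ.mk_inr_eq_mk_inl h.symm]
  · exact if_neg (not_le.2 h)

theorem FixesQuadrant.continuous_discChart {ψ : Torus ≃ₜ Torus} (hψ : FixesQuadrant ψ) :
    Continuous (discChart ψ) :=
  Continuous.if_le (continuous_quot_mk.comp (continuous_inl.comp continuous_quadrantParam))
    (continuous_quot_mk.comp (continuous_inr.comp continuous_quadrantParam))
    continuous_fst continuous_const fun _ hp => (hψ.mk_inr_eq_mk_inl hp).symm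

/-- A chart point with positive first coordinate has radius below 1 in H', so it is glued to no
point of H. -/
theorem mk_inl_eq_discChart_iff {ψ : Torus ≃ₜ Torus} {a : SolidTorus} {p : ℝ × ℝ × ℝ} :
    Quot.mk _ (Sum.inl a) = discChart ψ p ↔ a ∈ quadrant ∧ quadrantCoord (-1) a = p := by
  constructor
  · intro h
    rcases le_or_gt p.1 0 with hp | hp
    · rw [discChart_of_nonpos ψ hp, mk_inl_eq_mk_inl] at h
      rw [h]
      exact ⟨quadrantParam_mem p, quadrantCoord_quadrantParam (by rw [abs_of_nonpos hp]; ring)⟩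
    · rw [discChart, if_neg (not_le.2 hp)] at h
      obtain ⟨x, hx, -⟩ := mk_inr_eq_mk_inl.1 h.symm
      exact absurd (eq_zero_of_quadrantParam_eq_bdry hx) hp.ne'
  · rintro ⟨ha, rfl⟩
    rw [discChart_of_nonpos, quadrantParam_quadrantCoord (by simp) ha]
    change -1 * (1 / ‖(a.1 : ℂ)‖ - 1) ≤ 0
    linarith [one_le_one_div_norm ha]

theorem FixesQuadrant.mk_inr_eq_discChart_iff {ψ : Torus ≃ₜ Torus} (hψ : FixesQuadrant ψ)
    {a : SolidTorus} {p : ℝ × ℝ × ℝ} :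
    Quot.mk _ (Sum.inr a) = discChart ψ p ↔ a ∈ quadrant ∧ quadrantCoord 1 a = p := by
  constructor
  · intro h
    have key : 0 ≤ p.1 := by
      by_contra hp
      rw [discChart_of_nonpos ψ (not_le.1 hp).le] at h
      obtain ⟨x, -, hx⟩ := OneOneKnot.mk_inr_eq_mk_inl.1 h
      exact hp (eq_zero_of_quadrantParam_eq_bdry hx).ge
    rw [hψ.discChart_of_nonneg key, mk_inr_eq_mk_inr] at h
    rw [h]
    exact ⟨quadrantParam_mem p, quadrantCoord_quadrantParam (by rw [abs_of_nonneg key]; ring)⟩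
  · rintro ⟨ha, rfl⟩
    rw [hψ.discChart_of_nonneg, quadrantParam_quadrantCoord (by simp) ha]
    change 0 ≤ 1 * (1 / ‖(a.1 : ℂ)‖ - 1)
    linarith [one_le_one_div_norm ha]

/-- Openness in the quotient is tested on the two solid tori, where the image of an open set pulls
back to its preimage under the continuous coordinates on the open quadrant. -/
theorem FixesQuadrant.isOpenEmbedding_discChart {ψ : Torus ≃ₜ Torus} (hψ : FixesQuadrant ψ) :
    Topology.IsOpenEmbedding (discChart ψ) := by
  refine .of_continuous_injective_isOpenMap hψ.continuous_discChart ?_ ?_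
  · intro p p' h
    rcases le_total p.1 0 with hp | hp
    · have h1 := (discChart_of_nonpos ψ hp).symm
      exact (mk_inl_eq_discChart_iff.1 h1).2.symm.trans (mk_inl_eq_discChart_iff.1 (h1.trans h)).2
    · have h1 := (hψ.discChart_of_nonneg hp).symm
      exact (hψ.mk_inr_eq_discChart_iff.1 h1).2.symm.trans
        (hψ.mk_inr_eq_discChart_iff.1 (h1.trans h)).2
  · intro O hO
    rw [← isQuotientMap_quot_mk.isOpen_preimage, isOpen_sum_iff]
    constructor
    · have h : Sum.inl ⁻¹' (Quot.mk (GlueRel ψ) ⁻¹' (discChart ψ '' O)) =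
          quadrant ∩ quadrantCoord (-1) ⁻¹' O := by
        ext a
        constructor
        · rintro ⟨p, hp, h⟩
          obtain ⟨h1, rfl⟩ := mk_inl_eq_discChart_iff.1 h.symm
          exact ⟨h1, hp⟩
        · rintro ⟨h1, h2⟩
          exact ⟨_, h2, (mk_inl_eq_discChart_iff.2 ⟨h1, rfl⟩).symm⟩
      rw [h]
      exact (continuousOn_quadrantCoord _).isOpen_inter_preimage isOpen_quadrant hO
    · have h : Sum.inr ⁻¹' (Quot.mk (GlueRel ψ) ⁻¹' (discChart ψ '' O)) =
          quadrant ∩ quadrantCoord 1 ⁻¹' O := by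
        ext a
        constructor
        · rintro ⟨p, hp, h⟩
          obtain ⟨h1, rfl⟩ := hψ.mk_inr_eq_discChart_iff.1 h.symm
          exact ⟨h1, hp⟩
        · rintro ⟨h1, h2⟩
          exact ⟨_, h2, (hψ.mk_inr_eq_discChart_iff.2 ⟨h1, rfl⟩).symm⟩
      rw [h]
      exact (continuousOn_quadrantCoord _).isOpen_inter_preimage isOpen_quadrant hO

/-- The boundary of the square `[-1, 1]²` in the plane `t = 0`. -/
def squareBoundary : Set (ℝ × ℝ × ℝ) := {p | max |p.1| |p.2.1| = 1 ∧ p.2.2 = 0}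

theorem arc_subset_quadrant : arc ⊆ quadrant := by
  rintro a (⟨⟨s, h1, -, h3⟩, h4⟩ | ⟨h1, h2⟩)
  · refine ⟨?_, by linarith⟩
    rw [h3, Complex.neg_re, Complex.ofReal_re]
    linarith
  · refine ⟨?_, by linarith⟩
    rw [h1]
    norm_num

theorem leftPoint_re_le_iff (y : ℝ) : (leftPoint (4 / 3 * y) : ℂ).re ≤ -3 / 5 ↔ |y| ≤ 1 := by
  rw [leftPoint_re, ← sq_le_one_iff_abs_le_one]
  have h1 : 0 < √(1 + (4 / 3 * y) ^ 2) := by positivity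
  have h2 : -(1 / √(1 + (4 / 3 * y) ^ 2)) ≤ -3 / 5 ↔ √(1 + (4 / 3 * y) ^ 2) ≤ 5 / 3 := by
    rw [neg_div, neg_le_neg_iff, le_div_iff₀ h1]
    constructor <;> intro h <;> linarith
  rw [h2, Real.sqrt_le_left (by norm_num)]
  constructor <;> intro h <;> nlinarith

theorem leftPoint_re_eq_iff (y : ℝ) : (leftPoint (4 / 3 * y) : ℂ).re = -3 / 5 ↔ |y| = 1 := by
  rw [leftPoint_re, ← sq_eq_sq₀ (abs_nonneg y) zero_le_one, sq_abs, one_pow]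
  have h1 : 0 < √(1 + (4 / 3 * y) ^ 2) := by positivity
  have h2 : -(1 / √(1 + (4 / 3 * y) ^ 2)) = -3 / 5 ↔ √(1 + (4 / 3 * y) ^ 2) = 5 / 3 := by
    rw [neg_div, neg_inj, div_eq_iff h1.ne']
    constructor <;> intro h <;> linarith
  rw [h2, Real.sqrt_eq_iff_mul_self_eq (by positivity) (by norm_num)]
  constructor <;> intro h <;> nlinarith

theorem leftPoint_zero : leftPoint 0 = -1 := by
  simp [leftPoint]

theorem half_le_chartRadius_iff {x : ℝ} : 1 / 2 ≤ (chartRadius x : ℝ) ↔ |x| ≤ 1 := by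
  change 1 / 2 ≤ 1 / (1 + |x|) ↔ _
  rw [div_le_div_iff_of_pos_left one_pos two_pos (by positivity)]
  constructor <;> intro h <;> linarith

theorem chartRadius_eq_half_iff {x : ℝ} : (chartRadius x : ℝ) = 1 / 2 ↔ |x| = 1 := by
  change 1 / (1 + |x|) = 1 / 2 ↔ _
  rw [div_eq_div_iff (by positivity) two_ne_zero]
  constructor <;> intro h <;> linarith

theorem max_eq_one_iff {r s : ℝ} : max r s = 1 ↔ (r ≤ 1 ∧ s = 1) ∨ (r = 1 ∧ s ≤ 1) := by
  grind

/-- The radial legs are the sides |y| = 1 and the inner piece is the side |x| = 1. Only |x| enters,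
so the same criterion serves for both copies of the arc. -/
theorem quadrantParam_mem_arc_iff (p : ℝ × ℝ × ℝ) :
    quadrantParam p ∈ arc ↔ p ∈ squareBoundary := by
  have hy := leftPoint_re_le_iff p.2.1
  have hy' := leftPoint_re_eq_iff p.2.1
  have hs := half_le_chartRadius_iff (x := p.1)
  have hs' := chartRadius_eq_half_iff (x := p.1)
  have hpos := chartRadius_pos p.1
  have key : ∀ s : ℝ, 0 < s → (((quadrantParam p).1 : ℂ) = -(s : ℂ) ↔
      (chartRadius p.1 : ℝ) = s ∧ p.2.2 = 0) := by
    intro s hs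
    constructor
    · intro h
      have h1 : (chartRadius p.1 : ℝ) = s := by
        rw [← norm_quadrantParam, h, norm_neg, Complex.norm_real, Real.norm_of_nonneg hs.le]
      refine ⟨h1, ?_⟩
      rw [quadrantParam_coe, h1] at h
      have h2 := congrArg Complex.im h
      rw [Complex.im_ofReal_mul, leftPoint_im, Complex.neg_im, Complex.ofReal_im, neg_zero] at h2
      have h3 : √(1 + p.2.2 ^ 2) ≠ 0 := by positivity
      simpa [hs.ne', h3] using h2
    · rintro ⟨h1, h2⟩
      rw [quadrantParam_coe, h1, h2, leftPoint_zero]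
      simp
  have hkey := key (1 / 2) (by norm_num)
  push_cast at hkey
  change ((∃ s : ℝ, 1 / 2 ≤ s ∧ s ≤ 1 ∧ ((quadrantParam p).1 : ℂ) = -(s : ℂ)) ∧
    ((quadrantParam p).2 : ℂ).re = -3 / 5) ∨ (((quadrantParam p).1 : ℂ) = -(1 / 2) ∧
    ((quadrantParam p).2 : ℂ).re ≤ -3 / 5) ↔ max |p.1| |p.2.1| = 1 ∧ p.2.2 = 0
  rw [quadrantParam_snd, hy, hy', hkey, hs']
  have h1 : (∃ s : ℝ, 1 / 2 ≤ s ∧ s ≤ 1 ∧ ((quadrantParam p).1 : ℂ) = -(s : ℂ)) ↔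
      |p.1| ≤ 1 ∧ p.2.2 = 0 := by
    rw [← hs]
    constructor
    · rintro ⟨s, h1, -, h3⟩
      obtain ⟨rfl, h4⟩ := (key s (by linarith)).1 h3
      exact ⟨h1, h4⟩
    · rintro ⟨h1, h2⟩
      exact ⟨_, h1, (chartRadius p.1).2.2, (key _ hpos).2 ⟨rfl, h2⟩⟩
  rw [h1]
  rw [max_eq_one_iff]
  tauto

theorem FixesQuadrant.knot_eq {ψ : Torus ≃ₜ Torus} (hψ : FixesQuadrant ψ) :
    knot ψ = discChart ψ '' squareBoundary := by
  apply Set.Subset.antisymm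
  · rintro _ ⟨_, ⟨a, ha, rfl⟩ | ⟨a, ha, rfl⟩, rfl⟩
    · have h := mk_inl_eq_discChart_iff (ψ := ψ).2 ⟨arc_subset_quadrant ha, rfl⟩
      refine ⟨_, ?_, h.symm⟩
      rwa [← quadrantParam_mem_arc_iff,
        quadrantParam_quadrantCoord (by simp) (arc_subset_quadrant ha)]
    · have h := hψ.mk_inr_eq_discChart_iff.2 ⟨arc_subset_quadrant ha, rfl⟩
      refine ⟨_, ?_, h.symm⟩
      rwa [← quadrantParam_mem_arc_iff,
        quadrantParam_quadrantCoord (by simp) (arc_subset_quadrant ha)]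
  · rintro _ ⟨p, hp, rfl⟩
    rw [← quadrantParam_mem_arc_iff] at hp
    rcases le_total p.1 0 with h | h
    · rw [discChart_of_nonpos ψ h]
      exact ⟨_, Or.inl ⟨_, hp, rfl⟩, rfl⟩
    · rw [hψ.discChart_of_nonneg h]
      exact ⟨_, Or.inr ⟨_, hp, rfl⟩, rfl⟩

/-- A homeomorphism of `ℂ` onto the plane that maps the unit circle onto the boundary of the
square `[-1, 1]²`. -/
theorem exists_homeomorph_sphere_eq_square :
    ∃ h : ℂ ≃ₜ ℝ × ℝ, h '' Metric.sphere 0 1 = Metric.sphere 0 1 := by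
  let L := Complex.equivRealProdCLM
  let s : Set ℂ := L ⁻¹' Metric.ball 0 1
  have hc : Convex ℝ s := (convex_ball (0 : ℝ × ℝ) 1).linear_preimage L.toLinearMap
  have hb : Bornology.IsBounded s := by
    have : s = L.symm '' Metric.ball 0 1 := by
      rw [L.symm.image_eq_preimage_symm]
      rfl
    rw [this]
    exact Metric.isBounded_ball.image L.symm.toContinuousLinearMap
  have ho : IsOpen s := Metric.isOpen_ball.preimage L.continuous
  have hne : (interior s).Nonempty := by
    rw [ho.interior_eq]
    exact ⟨0, by simp [s]⟩
  -- The product norm on ℝ × ℝ is the maximum norm, so its unit ball is an open square: a bounded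
  -- convex set with interior points.
  obtain ⟨h, -, -, h3⟩ := exists_homeomorph_image_interior_closure_frontier_eq_unitBall hc hne hb
  refine ⟨h.symm.trans L.toHomeomorph, ?_⟩
  have h4 : frontier s = L ⁻¹' Metric.sphere 0 1 := by
    rw [← frontier_ball (0 : ℝ × ℝ) one_ne_zero]
    exact (L.toHomeomorph.preimage_frontier _).symm
  change (L ∘ h.symm) '' _ = _
  rw [← h3, h4, Set.image_comp, ← Set.image_comp h.symm]
  simp only [Homeomorph.symm_comp_self, Set.image_id]
  exact Set.image_preimage_eq _ L.surjective

theorem FixesQuadrant.isTrivialKnot {ψ : Torus ≃ₜ Torus} (hψ : FixesQuadrant ψ) :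
    IsTrivialKnot (knot ψ) := by
  obtain ⟨h, hh⟩ := exists_homeomorph_sphere_eq_square
  let k : ℂ × ℝ ≃ₜ ℝ × ℝ × ℝ :=
    (h.prodCongr (Homeomorph.refl ℝ)).trans (Homeomorph.prodAssoc ℝ ℝ ℝ)
  refine ⟨discChart ψ ∘ k, hψ.isOpenEmbedding_discChart.comp k.isOpenEmbedding, ?_⟩
  rw [Set.image_comp, hψ.knot_eq]
  congr 1
  ext ⟨x, y, t⟩
  have h1 : max |x| |y| = 1 ↔ (x, y) ∈ h '' Metric.sphere 0 1 := by
    rw [hh, mem_sphere_zero_iff_norm]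
    rfl
  change _ ↔ max |x| |y| = 1 ∧ t = 0
  rw [h1]
  constructor
  · rintro ⟨⟨z, t'⟩, ⟨hz, ht⟩, he⟩
    have he' : ((h z).1, (h z).2, t') = (x, y, t) := he
    simp only [Prod.mk.injEq] at he'
    exact ⟨⟨z, hz, Prod.ext he'.1 he'.2.1⟩, he'.2.2 ▸ ht⟩
  · rintro ⟨⟨z, hz, e1⟩, rfl⟩
    refine ⟨(z, 0), ⟨hz, rfl⟩, ?_⟩
    change ((h z).1, (h z).2, (0 : ℝ)) = _
    rw [e1]

/-! ### Mapping classes with a linear isotopy class of the unpunctured torus -/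

/-- The linear self-homeomorphism of the torus given by an integral matrix. -/
def linearHomeo (M : SL(2, ℤ)) : Torus ≃ₜ Torus where
  toFun := linearMap M
  invFun := linearMap M⁻¹
  left_inv x := by rw [← ContinuousMap.comp_apply, ← linearMap_mul, inv_mul_cancel, linearMap_one]; rfl
  right_inv x := by
    rw [← ContinuousMap.comp_apply, ← linearMap_mul, mul_inv_cancel, linearMap_one]; rfl
  continuous_toFun := (linearMap M).continuous
  continuous_invFun := (linearMap M⁻¹).continuous

theorem linearHomeo_apply (M : SL(2, ℤ)) (x : Torus) :
    linearHomeo M x = (x.1 ^ (M.1 0 0) * x.2 ^ (M.1 0 1), x.1 ^ (M.1 1 0) * x.2 ^ (M.1 1 1)) := rfl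

theorem linearHomeo_one : linearHomeo 1 = 1 := by
  ext1 x
  change linearMap 1 x = x
  rw [linearMap_one]
  rfl

theorem linearHomeo_mul (M N : SL(2, ℤ)) : linearHomeo (M * N) = linearHomeo M * linearHomeo N := by
  ext1 x
  change linearMap (M * N) x = linearMap M (linearMap N x)
  rw [linearMap_mul]
  rfl

theorem linearHomeo_inv (M : SL(2, ℤ)) : linearHomeo M⁻¹ = (linearHomeo M)⁻¹ := by
  rw [eq_inv_iff_mul_eq_one, ← linearHomeo_mul, inv_mul_cancel, linearHomeo_one]

/-- Isotopy of self-homeomorphisms of the torus, without regard to punctures. -/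
def TorusIsotopic (f g : Torus ≃ₜ Torus) : Prop :=
  ∃ F : I → Torus ≃ₜ Torus, Continuous (fun q : I × Torus => F q.1 q.2) ∧ F 0 = f ∧ F 1 = g

theorem TorusIsotopic.mul {f f' g g' : Torus ≃ₜ Torus} (h : TorusIsotopic f g)
    (h' : TorusIsotopic f' g') : TorusIsotopic (f * f') (g * g') := by
  obtain ⟨F, hF, rfl, rfl⟩ := h
  obtain ⟨F', hF', rfl, rfl⟩ := h'
  exact ⟨fun t => F t * F' t, hF.comp (continuous_fst.prodMk hF'), rfl, rfl⟩

theorem TorusIsotopic.inv {f g : Torus ≃ₜ Torus} (h : TorusIsotopic f g) :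
    TorusIsotopic f⁻¹ g⁻¹ := by
  obtain ⟨F, hF, rfl, rfl⟩ := h
  exact ⟨fun t => (F t)⁻¹, continuous_symm_of_continuous hF, rfl, rfl⟩

theorem TorusIsotopic.refl (f : Torus ≃ₜ Torus) : TorusIsotopic f f :=
  ⟨fun _ => f, f.continuous.comp continuous_snd, rfl, rfl⟩

/-- The pairs of a mapping class and a matrix such that some homeomorphism in the class is the
identity near the disc bounded by the arc and is isotopic, in the unpunctured torus, to the linear
map of the matrix. -/
def linearPairs : Subgroup (MCG₂ × SL(2, ℤ)) where
  carrier := {x | ∃ ψ : PuncturedHomeo, QuotientGroup.mk ψ = x.1 ∧ FixesQuadrant ψ.1 ∧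
    TorusIsotopic (linearHomeo x.2) ψ.1}
  mul_mem' := by
    rintro ⟨_, M⟩ ⟨_, N⟩ ⟨ψ, rfl, h1, h2⟩ ⟨χ, rfl, h3, h4⟩
    refine ⟨ψ * χ, rfl, fun x hx hx' => ?_, ?_⟩
    · change ψ.1 (χ.1 x) = x
      rw [h3 x hx hx', h1 x hx hx']
    · change TorusIsotopic (linearHomeo (M * N)) _
      rw [linearHomeo_mul]
      exact h2.mul h4
  one_mem' := ⟨1, rfl, fun _ _ _ => rfl, by
    change TorusIsotopic (linearHomeo 1) 1
    rw [linearHomeo_one]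
    exact TorusIsotopic.refl 1⟩
  inv_mem' := by
    rintro ⟨_, M⟩ ⟨ψ, rfl, h1, h2⟩
    refine ⟨ψ⁻¹, rfl, fun x hx hx' => ?_, ?_⟩
    · change ψ.1.symm x = x
      rw [Homeomorph.symm_apply_eq, h1 x hx hx']
    · change TorusIsotopic (linearHomeo M⁻¹) _
      rw [linearHomeo_inv]
      exact h2.inv

/-- The matrix of the twist around the longitude. -/
def matα : SL(2, ℤ) := ⟨!![1, 0; 1, 1], by simp⟩

/-- The matrix of the twist around the meridian. -/
def matβ : SL(2, ℤ) := ⟨!![1, -1; 0, 1], by simp⟩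

theorem tα_mem_linearPairs : (tα, matα) ∈ linearPairs := by
  refine ⟨⟨twistα, twistα_mem⟩, rfl, fun x hx hx' => ?_, ?_⟩
  · simp [twistα, twistAngle_of_neg _ hx]
  · obtain ⟨F, hF, hF0, hF1⟩ := exists_homotopy_twistAngle
    have hc : ∀ t, Continuous fun u => F (t, u) := fun t => hF.comp (by fun_prop)
    -- A shear is invertible for any circle map F (t, ·), so a homotopy of the twist angle already
    -- gives an isotopy of the torus.
    refine ⟨fun t => ⟨⟨fun x => (x.1, x.2 * F (t, x.1)), fun x => (x.1, x.2 / F (t, x.1)),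
      fun x => by simp, fun x => by simp⟩,
      continuous_fst.prodMk (continuous_snd.mul ((hc t).comp continuous_fst)),
      continuous_fst.prodMk (continuous_snd.div' ((hc t).comp continuous_fst))⟩, ?_, ?_, ?_⟩
    · exact (continuous_fst.comp continuous_snd).prodMk
        ((continuous_snd.comp continuous_snd).mul
          (hF.comp (continuous_fst.prodMk (continuous_fst.comp continuous_snd))))
    · ext1 x
      rw [linearHomeo_apply]
      simp [hF0, matα, mul_comm]
    · ext1 x
      simp [hF1, twistα]

theorem tβ_mem_linearPairs : (tβ, matβ) ∈ linearPairs := by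
  refine ⟨⟨twistβ, twistβ_mem⟩, rfl, fun x hx hx' => ?_, ?_⟩
  · simp [twistβ, twistAngle_of_neg _ hx']
  · obtain ⟨F, hF, hF0, hF1⟩ := exists_homotopy_twistAngle
    have hc : ∀ t, Continuous fun u => F (t, u) := fun t => hF.comp (by fun_prop)
    refine ⟨fun t => ⟨⟨fun x => (x.1 / F (t, x.2), x.2), fun x => (x.1 * F (t, x.2), x.2),
      fun x => by simp, fun x => by simp⟩,
      (continuous_fst.div' ((hc t).comp continuous_snd)).prodMk continuous_snd,
      (continuous_fst.mul ((hc t).comp continuous_snd)).prodMk continuous_snd⟩, ?_, ?_, ?_⟩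
    · exact ((continuous_fst.comp continuous_snd).div'
        (hF.comp (continuous_fst.prodMk (continuous_snd.comp continuous_snd)))).prodMk
        (continuous_snd.comp continuous_snd)
    · ext1 x
      rw [linearHomeo_apply]
      simp [hF0, matβ, div_eq_mul_inv]
    · ext1 x
      simp [hF1, twistβ]

/-- Two isotopies are used for different purposes: one preserving the punctures carries the knot of
ψ to the knot of the representative χ fixing the quadrant; one ignoring them identifies the ambient
manifold of χ with that of the matrix. -/
theorem representsTrivialKnot_of_mem_linearPairs {c : MCG₂} {M : SL(2, ℤ)}
    (h : (c, M) ∈ linearPairs) {X : Type*} [TopologicalSpace X]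
    (e : Glued (linearHomeo M) ≃ₜ X) : RepresentsTrivialKnot c X := by
  intro ψ hψ
  obtain ⟨χ, rfl, hχ, F, hF, hF0, hF1⟩ := h
  obtain ⟨E, hE, hE0, hE1⟩ := (mk_eq_mk_iff ψ χ).1 hψ
  obtain ⟨e1, h1⟩ := exists_glued_homeomorph_of_isotopy (F := fun t => (E t).1) hE
  obtain ⟨e2, -⟩ := exists_glued_homeomorph_of_isotopy hF
  replace h1 := h1 fun t => (E t).2.2
  dsimp only at hF0 hF1
  subst hE0 hE1
  rw [hF0, hF1] at e2
  refine ⟨e1.trans (e2.symm.trans e), ?_⟩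
  change IsTrivialKnot (((e2.symm.trans e) ∘ e1) '' _)
  rw [Set.image_comp, h1]
  exact hχ.isTrivialKnot.image _

/-! ### Continued fractions -/

/-- The matrix of `altProd`. -/
def altMat : List ℕ → SL(2, ℤ)
  | [] => 1
  | [a] => matα ^ a
  | a :: b :: l => matα ^ a * matβ ^ (-(b : ℤ)) * altMat l

theorem altProd_mem_linearPairs : ∀ l : List ℕ, (altProd l, altMat l) ∈ linearPairs
  | [] => one_mem _
  | [a] => pow_mem tα_mem_linearPairs a
  | a :: b :: l => mul_mem (mul_mem (pow_mem tα_mem_linearPairs a)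
      (zpow_mem tβ_mem_linearPairs (-(b : ℤ)))) (altProd_mem_linearPairs l)

theorem matα_pow (a : ℕ) : (matα ^ a).1 = !![1, 0; (a : ℤ), 1] := by
  induction a with
  | zero => simp [Matrix.one_fin_two]
  | succ a ih =>
    rw [pow_succ, Matrix.SpecialLinearGroup.coe_mul, ih]
    simp [matα]

theorem matβ_zpow_neg (b : ℕ) : (matβ ^ (-(b : ℤ))).1 = !![1, (b : ℤ); 0, 1] := by
  rw [zpow_neg, zpow_natCast, ← inv_pow]
  induction b with
  | zero => simp [Matrix.one_fin_two]
  | succ b ih =>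
    rw [pow_succ, Matrix.SpecialLinearGroup.coe_mul, ih, Matrix.SpecialLinearGroup.coe_inv]
    simp [matβ, Matrix.adjugate_fin_two, add_comm]

/-- The first column for lists of odd length, the second column for lists of even length. -/
theorem altMat_column : ∀ l : List ℕ, (∀ n ∈ l, 0 < n) → ∃ n m : ℕ, 0 < m ∧
    (contFrac l)⁻¹ = (n : ℚ) / m ∧
    (altMat l).1 0 (if Odd l.length then 0 else 1) = n ∧
    (altMat l).1 1 (if Odd l.length then 0 else 1) = m
  -- Working with the inverse makes the convention 0⁻¹ = 0 fit: the empty list gives 0/1, the second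
  -- column of the identity.
  | [], _ => ⟨0, 1, one_pos, by simp [contFrac], by simp [altMat], by simp [altMat]⟩
  | [a], h => ⟨1, a, h a (by simp), by simp [contFrac], by rw [altMat, matα_pow]; simp,
      by rw [altMat, matα_pow]; simp⟩
  | a :: b :: l, h => by
    obtain ⟨n, m, hm, hc, h0, h1⟩ := altMat_column l fun n hn => h n (by simp [hn])
    have hb : 0 < b := h b (by simp)
    have hodd : Odd (a :: b :: l).length ↔ Odd l.length := by
      simp only [List.length_cons]
      grind
    -- This is the image of (n, m) under the matrix with rows (1, b) and (a, 1 + ab), matching a + 1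
    -- / (b + n / m).
    refine ⟨n + b * m, m + a * (n + b * m), by positivity, ?_, ?_, ?_⟩
    · have hn' : (n + b * m : ℚ) ≠ 0 := by positivity
      have hm' : (m : ℚ) ≠ 0 := by positivity
      rw [contFrac, contFrac, hc, ← inv_div]
      push_cast
      field_simp
      ring
    · simp only [hodd]
      rw [altMat, Matrix.SpecialLinearGroup.coe_mul, Matrix.SpecialLinearGroup.coe_mul, matα_pow,
        matβ_zpow_neg]
      simp [Matrix.mul_apply, Fin.sum_univ_two, h0, h1]
    · simp only [hodd]
      rw [altMat, Matrix.SpecialLinearGroup.coe_mul, Matrix.SpecialLinearGroup.coe_mul, matα_pow,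
        matβ_zpow_neg]
      simp [Matrix.mul_apply, Fin.sum_univ_two, h0, h1]
      ring

/-- A column of a matrix of determinant 1 is coprime, so the two fractions are both in lowest terms
and their entries agree. -/
theorem altMat_column_eq {p q : ℕ} {l : List ℕ} (hq : 0 < q) (hqp : q < p) (hpq : Nat.Coprime p q)
    (hl : ∀ n ∈ l, 0 < n) (hc : contFrac l = (p : ℚ) / q) :
    (altMat l).1 0 (if Odd l.length then 0 else 1) = q ∧
    (altMat l).1 1 (if Odd l.length then 0 else 1) = p := by
  obtain ⟨n, m, hm, h, h0, h1⟩ := altMat_column l hl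
  have hdet := (altMat l).2
  rw [Matrix.det_fin_two] at hdet
  have hnm : IsCoprime (n : ℤ) (m : ℤ) := by
    rw [← h0, ← h1]
    split_ifs
    · exact ⟨(altMat l).1 1 1, -(altMat l).1 0 1, by linarith⟩
    · exact ⟨-(altMat l).1 1 0, (altMat l).1 0 0, by linarith⟩
  rw [hc, inv_div] at h
  have h' : ((q : ℤ) : ℚ) / (p : ℤ) = ((n : ℤ) : ℚ) / (m : ℤ) := by
    simpa only [Int.cast_natCast] using h
  obtain ⟨e1, e2⟩ := Rat.div_int_inj (a := q) (b := p) (by omega) (by omega)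
    hpq.symm (Int.isCoprime_iff_gcd_eq_one.1 hnm) h'
  rw [h0, h1, e1, e2]
  exact ⟨rfl, rfl⟩

/-- The matrix of `t_β t_α t_β`. -/
def matS : SL(2, ℤ) := matβ * matα * matβ

theorem matS_coe : matS.1 = !![0, -1; 1, 0] := by
  rw [matS, Matrix.SpecialLinearGroup.coe_mul, Matrix.SpecialLinearGroup.coe_mul]
  simp [matα, matβ]

theorem matS_mem_linearPairs : (tβ * tα * tβ, matS) ∈ linearPairs :=
  mul_mem (mul_mem tβ_mem_linearPairs tα_mem_linearPairs) tβ_mem_linearPairs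

/-! ### The ambient manifolds of linear gluing maps -/

/-- Both targets are the quotient of X by the same kernel. Each ambient manifold is identified in
this way, by comparing kernels. -/
theorem nonempty_homeomorph_of_isQuotientMap {X Y Z : Type*} [TopologicalSpace X]
    [TopologicalSpace Y] [TopologicalSpace Z] {f : X → Y} {g : X → Z}
    (hf : Topology.IsQuotientMap f) (hg : Topology.IsQuotientMap g)
    (h : ∀ a b, f a = f b ↔ g a = g b) : Nonempty (Y ≃ₜ Z) := by
  have e1 := Topology.IsQuotientMap.homeomorph (f := ⟨f, hf.continuous⟩) hf
  have e2 := Topology.IsQuotientMap.homeomorph (f := ⟨g, hg.continuous⟩) hg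
  have hk : Setoid.ker (⟨f, hf.continuous⟩ : C(X, Y)) =
      Setoid.ker (⟨g, hg.continuous⟩ : C(X, Z)) := Setoid.ext h
  rw [hk] at e1
  exact ⟨e1.symm.trans e2⟩

/-- To compare the kernels of two maps on a sum, it suffices to compare three kinds of pairs. -/
theorem ker_sum_iff {A B Y Z : Type*} {f : A ⊕ B → Y} {g : A ⊕ B → Z}
    (h1 : ∀ a a', f (Sum.inl a) = f (Sum.inl a') ↔ g (Sum.inl a) = g (Sum.inl a'))
    (h2 : ∀ b b', f (Sum.inr b) = f (Sum.inr b') ↔ g (Sum.inr b) = g (Sum.inr b'))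
    (h3 : ∀ b a, f (Sum.inr b) = f (Sum.inl a) ↔ g (Sum.inr b) = g (Sum.inl a)) :
    ∀ s t, f s = f t ↔ g s = g t := by
  rintro (a | b) (a' | b')
  · exact h1 a a'
  · rw [eq_comm, h3, eq_comm]
  · exact h3 b a'
  · exact h2 b b'

/-! ### Lens spaces as quotients of the maximum norm sphere -/

/-- The unit sphere of `ℂ × ℂ` for the supremum norm, mapped radially to the 3-sphere. -/
def toSphere (v : {v : ℂ × ℂ // ‖v‖ = 1}) : Sphere3 :=
  ⟨(‖(!₂[v.1.1, v.1.2] : EuclideanSpace ℂ (Fin 2))‖⁻¹ : ℝ) •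
    (!₂[v.1.1, v.1.2] : EuclideanSpace ℂ (Fin 2)), by
    rw [mem_sphere_zero_iff_norm, norm_smul, norm_inv, norm_norm]
    refine inv_mul_cancel₀ (norm_ne_zero_iff.2 fun h => ?_)
    have h0 : v.1.1 = 0 := congrArg (fun w : EuclideanSpace ℂ (Fin 2) => w 0) h
    have h1 : v.1.2 = 0 := congrArg (fun w : EuclideanSpace ℂ (Fin 2) => w 1) h
    have h2 := v.2
    rw [Prod.norm_def, h0, h1] at h2
    simp at h2⟩

/-- The radial factor of `toSphere`. -/
def radialFactor (v : ℂ × ℂ) : ℝ := ‖(!₂[v.1, v.2] : EuclideanSpace ℂ (Fin 2))‖⁻¹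

theorem toSphere_zero (v : {v : ℂ × ℂ // ‖v‖ = 1}) :
    (toSphere v).1 0 = (radialFactor v.1 : ℂ) * v.1.1 := rfl

theorem toSphere_one (v : {v : ℂ × ℂ // ‖v‖ = 1}) :
    (toSphere v).1 1 = (radialFactor v.1 : ℂ) * v.1.2 := rfl

theorem radialFactor_pos (v : {v : ℂ × ℂ // ‖v‖ = 1}) : 0 < radialFactor v.1 := by
  refine lt_of_le_of_ne (inv_nonneg.2 (norm_nonneg _)) fun h => ?_
  have h1 := mem_sphere_zero_iff_norm.1 (toSphere v).2
  have h2 : (toSphere v).1 = 0 := by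
    change (radialFactor v.1 : ℝ) • _ = _
    rw [← h, zero_smul]
  rw [h2, norm_zero] at h1
  exact zero_ne_one h1

/-- Hence radial projection commutes with multiplying the coordinates by unit complex numbers. -/
theorem radialFactor_eq {v w : ℂ × ℂ} (h1 : ‖v.1‖ = ‖w.1‖) (h2 : ‖v.2‖ = ‖w.2‖) :
    radialFactor v = radialFactor w := by
  simp [radialFactor, EuclideanSpace.norm_eq, Fin.sum_univ_two, h1, h2]

theorem continuous_toSphere : Continuous toSphere := by
  have h : Continuous fun v : {v : ℂ × ℂ // ‖v‖ = 1} =>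
      (!₂[v.1.1, v.1.2] : EuclideanSpace ℂ (Fin 2)) := by fun_prop
  refine Continuous.subtype_mk (Continuous.smul (h.norm.inv₀ fun v hv => ?_) h) _
  have := radialFactor_pos v
  rw [radialFactor, hv, inv_zero] at this
  exact lt_irrefl _ this

theorem toSphere_surjective : Function.Surjective toSphere := by
  rintro ⟨w, hw⟩
  have hw0 : ‖(w 0, w 1)‖ ≠ 0 := by
    rw [norm_ne_zero_iff]
    intro h
    have : w = 0 := by
      ext i
      fin_cases i
      · exact congrArg Prod.fst h
      · exact congrArg Prod.snd h
    rw [this] at hw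
    simp at hw
  set r : ℝ := ‖(w 0, w 1)‖⁻¹ with hr
  have hr0 : 0 < r := inv_pos.2 (lt_of_le_of_ne (norm_nonneg _) hw0.symm)
  refine ⟨⟨r • (w 0, w 1), ?_⟩, ?_⟩
  · rw [norm_smul, Real.norm_of_nonneg hr0.le, hr, inv_mul_cancel₀ hw0]
  · have e : (!₂[r • w 0, r • w 1] : EuclideanSpace ℂ (Fin 2)) = r • w := by
      ext i
      fin_cases i <;> rfl
    apply Subtype.ext
    change (‖(!₂[r • w 0, r • w 1] : EuclideanSpace ℂ (Fin 2))‖⁻¹ : ℝ) •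
      (!₂[r • w 0, r • w 1] : EuclideanSpace ℂ (Fin 2)) = w
    rw [e, norm_smul, mem_sphere_zero_iff_norm.1 hw, mul_one, Real.norm_of_nonneg hr0.le, smul_smul,
      inv_mul_cancel₀ hr0.ne', one_smul]

theorem lensRel_equivalence {p q : ℕ} (hp : 0 < p) : Equivalence (lensRel p q) where
  refl x := ⟨1, by simp⟩
  symm := by
    rintro x y ⟨ζ, h, h0, h1⟩
    have hζ : ζ ≠ 0 := by
      rintro rfl
      rw [zero_pow hp.ne'] at h
      exact zero_ne_one h
    refine ⟨ζ⁻¹, by rw [inv_pow, h, inv_one], ?_, ?_⟩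
    · rw [h0, inv_mul_cancel_left₀ hζ]
    · rw [h1, inv_pow, inv_mul_cancel_left₀ (pow_ne_zero q hζ)]
  trans := by
    rintro x y z ⟨ζ, h, h0, h1⟩ ⟨ξ, h', h0', h1'⟩
    refine ⟨ξ * ζ, by rw [mul_pow, h, h', one_mul], ?_, ?_⟩
    · rw [h0', h0, mul_assoc]
    · rw [h1', h1, mul_pow, mul_assoc]

theorem lensRel_toSphere_iff {p q : ℕ} (hp : 0 < p) (v w : {v : ℂ × ℂ // ‖v‖ = 1}) :
    lensRel p q (toSphere v) (toSphere w) ↔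
      ∃ ζ : Circle, ζ ^ p = 1 ∧ w.1.1 = ζ * v.1.1 ∧ w.1.2 = (ζ : ℂ) ^ q * v.1.2 := by
  have hv := radialFactor_pos v
  have hw := radialFactor_pos w
  constructor
  · rintro ⟨ζ, h, h0, h1⟩
    have hζ := Complex.norm_eq_one_of_pow_eq_one h hp.ne'
    rw [toSphere_zero, toSphere_zero] at h0
    rw [toSphere_one, toSphere_one] at h1
    have e0 : radialFactor w.1 * ‖w.1.1‖ = radialFactor v.1 * ‖v.1.1‖ := by
      have := congrArg norm h0
      simpa [hζ, Real.norm_of_nonneg hv.le, Real.norm_of_nonneg hw.le, abs_of_pos hv,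
        abs_of_pos hw] using this
    have e1 : radialFactor w.1 * ‖w.1.2‖ = radialFactor v.1 * ‖v.1.2‖ := by
      have := congrArg norm h1
      simpa [hζ, Real.norm_of_nonneg hv.le, Real.norm_of_nonneg hw.le, abs_of_pos hv,
        abs_of_pos hw] using this
    -- Take the maximum of `e0` and `e1`: both points have maximum norm 1.
    have e : radialFactor w.1 = radialFactor v.1 := by
      have h2 := v.2
      have h3 := w.2
      rw [Prod.norm_def] at h2 h3
      have := congrArg₂ max e0 e1
      rwa [← mul_max_of_nonneg _ _ hv.le, ← mul_max_of_nonneg _ _ hw.le, h2, h3, mul_one,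
        mul_one] at this
    have hc : (radialFactor v.1 : ℂ) ≠ 0 := Complex.ofReal_ne_zero.2 hv.ne'
    rw [e, mul_left_comm] at h0 h1
    exact ⟨⟨ζ, mem_sphere_zero_iff_norm.2 hζ⟩, Circle.ext h, mul_left_cancel₀ hc h0,
      mul_left_cancel₀ hc h1⟩
  · rintro ⟨ζ, h, h0, h1⟩
    have e : radialFactor w.1 = radialFactor v.1 :=
      radialFactor_eq (by rw [h0, norm_mul, Circle.norm_coe, one_mul])
        (by rw [h1, norm_mul, norm_pow, Circle.norm_coe, one_pow, one_mul])
    refine ⟨ζ, by rw [← Circle.coe_pow, h, Circle.coe_one], ?_, ?_⟩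
    · rw [toSphere_zero, toSphere_zero, e, h0, mul_left_comm]
    · rw [toSphere_one, toSphere_one, e, h1, mul_left_comm]

/-! ### The covering of the two solid tori -/

/-- Rotation of a point of the closed disc. -/
def rotate (ξ : Circle) (z : Metric.closedBall (0 : ℂ) 1) : Metric.closedBall (0 : ℂ) 1 :=
  ⟨ξ * z, by
    rw [mem_closedBall_zero_iff, norm_mul, Circle.norm_coe, one_mul]
    exact mem_closedBall_zero_iff.1 z.2⟩

/-- Complex conjugation on the closed disc. -/
def conjDisc (z : Metric.closedBall (0 : ℂ) 1) : Metric.closedBall (0 : ℂ) 1 :=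
  ⟨starRingEnd ℂ z, by
    rw [mem_closedBall_zero_iff, Complex.norm_conj]
    exact mem_closedBall_zero_iff.1 z.2⟩

theorem continuous_rotate :
    Continuous fun q : Circle × Metric.closedBall (0 : ℂ) 1 => rotate q.1 q.2 :=
  Continuous.subtype_mk ((continuous_coe.comp continuous_fst).mul
    (continuous_subtype_val.comp continuous_snd)) _

theorem continuous_conjDisc : Continuous conjDisc :=
  Continuous.subtype_mk (Complex.continuous_conj.comp continuous_subtype_val) _

theorem norm_disc_circle (z : Metric.closedBall (0 : ℂ) 1) (u : Circle) :
    max ‖(z : ℂ)‖ ‖(u : ℂ)‖ = 1 := by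
  rw [Circle.norm_coe]
  exact max_eq_right (mem_closedBall_zero_iff.1 z.2)

/-- The two solid tori as the two halves of the supremum norm sphere. -/
def halves : SolidTorus ⊕ SolidTorus → {v : ℂ × ℂ // ‖v‖ = 1}
  | Sum.inl a => ⟨(a.2, a.1), by rw [Prod.norm_def, max_comm, norm_disc_circle]⟩
  | Sum.inr a => ⟨(a.1, a.2), by rw [Prod.norm_def, norm_disc_circle]⟩

theorem continuous_halves : Continuous halves := by
  have h1 : Continuous fun a : SolidTorus => (a.1 : ℂ) :=
    continuous_subtype_val.comp continuous_fst
  have h2 : Continuous fun a : SolidTorus => (a.2 : ℂ) := continuous_coe.comp continuous_snd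
  rw [continuous_sum_dom]
  exact ⟨Continuous.subtype_mk (h2.prodMk h1) _, Continuous.subtype_mk (h1.prodMk h2) _⟩

theorem halves_surjective : Function.Surjective halves := by
  rintro ⟨⟨x, y⟩, h⟩
  rw [Prod.norm_def] at h
  rcases max_choice ‖x‖ ‖y‖ with hm | hm
  · have hx : ‖x‖ = 1 := hm.symm.trans h
    refine ⟨Sum.inl (⟨y, ?_⟩, ⟨x, mem_sphere_zero_iff_norm.2 hx⟩), rfl⟩
    exact mem_closedBall_zero_iff.2 (h ▸ le_max_right _ _)
  · have hy : ‖y‖ = 1 := hm.symm.trans h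
    refine ⟨Sum.inr (⟨x, ?_⟩, ⟨y, mem_sphere_zero_iff_norm.2 hy⟩), rfl⟩
    exact mem_closedBall_zero_iff.2 (h ▸ le_max_left _ _)

theorem isQuotientMap_halves (p q : ℕ) : Topology.IsQuotientMap
    fun s => Quot.mk (lensRel p q) (toSphere (halves s)) :=
  isQuotientMap_quot_mk.comp (.of_surjective_continuous
    (toSphere_surjective.comp halves_surjective) (continuous_toSphere.comp continuous_halves))

theorem mk_halves_eq_iff {p q : ℕ} (hp : 0 < p) (s t : SolidTorus ⊕ SolidTorus) :
    Quot.mk (lensRel p q) (toSphere (halves s)) = Quot.mk (lensRel p q) (toSphere (halves t)) ↔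
      ∃ ζ : Circle, ζ ^ p = 1 ∧ (halves t).1.1 = ζ * (halves s).1.1 ∧
        (halves t).1.2 = (ζ : ℂ) ^ q * (halves s).1.2 := by
  rw [(lensRel_equivalence hp).quot_mk_eq_iff, lensRel_toSphere_iff hp]

/-- The covering of the two solid tori of a lens space. -/
def lensCover (M : SL(2, ℤ)) : SolidTorus ⊕ SolidTorus → SolidTorus ⊕ SolidTorus :=
  Sum.map (fun a => (rotate (a.2 ^ M.1 0 0) (conjDisc a.1), a.2 ^ M.1 1 0))
    (fun a => (rotate (a.2 ^ (-M.1 1 1)) a.1, a.2 ^ M.1 1 0))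

theorem continuous_lensCover (M : SL(2, ℤ)) : Continuous (lensCover M) := by
  refine Continuous.sumMap ?_ ?_
  · exact (continuous_rotate.comp ((continuous_snd.zpow _).prodMk
      (continuous_conjDisc.comp continuous_fst))).prodMk (continuous_snd.zpow _)
  · exact (continuous_rotate.comp ((continuous_snd.zpow _).prodMk continuous_fst)).prodMk
      (continuous_snd.zpow _)

theorem exists_circle_pow_eq {p : ℕ} (hp : 0 < p) (v : Circle) : ∃ x : Circle, x ^ p = v := by
  refine ⟨Circle.exp (Complex.arg v / p), ?_⟩
  rw [← Circle.exp_nsmul, nsmul_eq_mul, mul_div_cancel₀ _ (by positivity), Circle.exp_arg]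

theorem rotate_rotate (ξ η : Circle) (z : Metric.closedBall (0 : ℂ) 1) :
    rotate ξ (rotate η z) = rotate (ξ * η) z :=
  Subtype.ext (by simp [rotate, mul_assoc])

theorem rotate_one (z : Metric.closedBall (0 : ℂ) 1) : rotate 1 z = z :=
  Subtype.ext (by simp [rotate])

theorem conjDisc_conjDisc (z : Metric.closedBall (0 : ℂ) 1) : conjDisc (conjDisc z) = z :=
  Subtype.ext (by simp [conjDisc])

theorem lensCover_surjective {M : SL(2, ℤ)} {p : ℕ} (hp : 0 < p) (h : M.1 1 0 = p) :
    Function.Surjective (lensCover M) := by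
  refine Function.Surjective.sumMap ?_ ?_
  · rintro ⟨w, v⟩
    obtain ⟨x, rfl⟩ := exists_circle_pow_eq hp v
    refine ⟨(conjDisc (rotate (x ^ M.1 0 0)⁻¹ w), x), ?_⟩
    simp only [conjDisc_conjDisc, rotate_rotate, h, mul_inv_cancel, rotate_one, zpow_natCast]
  · rintro ⟨w, v⟩
    obtain ⟨x, rfl⟩ := exists_circle_pow_eq hp v
    refine ⟨(rotate (x ^ (-M.1 1 1))⁻¹ w, x), ?_⟩
    simp only [rotate_rotate, h, mul_inv_cancel, rotate_one, zpow_natCast]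

theorem isQuotientMap_lensCover {M : SL(2, ℤ)} {p : ℕ} (hp : 0 < p) (h : M.1 1 0 = p) :
    Topology.IsQuotientMap fun s => Quot.mk (GlueRel (linearHomeo M)) (lensCover M s) :=
  isQuotientMap_quot_mk.comp
    (.of_surjective_continuous (lensCover_surjective hp h) (continuous_lensCover M))

/-- On the half with |x| = 1, the monomials x^p and x^q · conj y are invariant under (x, y) ↦ (ζ x,
ζ^q y). They separate orbits, since ζ = x' / x is forced. -/
theorem mk_eq_iff_inl {M : SL(2, ℤ)} {p q : ℕ} (hp : 0 < p) (h0 : M.1 0 0 = q)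
    (h1 : M.1 1 0 = p) (a b : SolidTorus) :
    Quot.mk (lensRel p q) (toSphere (halves (Sum.inl a))) =
        Quot.mk (lensRel p q) (toSphere (halves (Sum.inl b))) ↔
      Quot.mk (GlueRel (linearHomeo M)) (lensCover M (Sum.inl a)) =
        Quot.mk (GlueRel (linearHomeo M)) (lensCover M (Sum.inl b)) := by
  obtain ⟨y, x⟩ := a
  obtain ⟨y', x'⟩ := b
  rw [mk_halves_eq_iff hp]
  simp only [lensCover, Sum.map_inl, h0, h1, zpow_natCast]
  rw [mk_inl_eq_mk_inl, Prod.mk.injEq, Subtype.ext_iff]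
  change (∃ ζ : Circle, ζ ^ p = 1 ∧ (x' : ℂ) = ζ * x ∧ (y' : ℂ) = (ζ : ℂ) ^ q * y) ↔
    ((x ^ q : Circle) : ℂ) * starRingEnd ℂ y = ((x' ^ q : Circle) : ℂ) * starRingEnd ℂ y' ∧ _
  constructor
  · rintro ⟨ζ, hζ, hx, hy⟩
    obtain rfl : x' = ζ * x := Circle.ext (by simpa using hx)
    refine ⟨?_, by rw [mul_pow, hζ, one_mul]⟩
    rw [hy, map_mul, ← Circle.coe_pow, ← Circle.coe_inv_eq_conj, ← mul_assoc, ← Circle.coe_mul,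
      mul_pow, mul_comm (ζ ^ q), mul_inv_cancel_right]
  · rintro ⟨hy, hx⟩
    refine ⟨x' / x, by rw [div_pow, hx, div_self'], by rw [← Circle.coe_mul, div_mul_cancel], ?_⟩
    have h2 := congrArg (starRingEnd ℂ) hy
    simp only [map_mul, Complex.conj_conj, ← Circle.coe_inv_eq_conj] at h2
    rw [← Circle.coe_pow, div_pow, Circle.coe_div, div_mul_eq_mul_div, eq_div_iff
      (Circle.coe_ne_zero _)]
    rw [Circle.coe_inv, Circle.coe_inv, inv_mul_eq_div, inv_mul_eq_div,
      div_eq_div_iff (Circle.coe_ne_zero _) (Circle.coe_ne_zero _)] at h2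
    rw [← h2, mul_comm]

theorem pow_det_relation {M : SL(2, ℤ)} {p q : ℕ} (h0 : M.1 0 0 = q) (h1 : M.1 1 0 = p)
    {η : Circle} (hη : η ^ p = 1) : (η ^ M.1 1 1) ^ q = η := by
  have hdet := M.2
  rw [Matrix.det_fin_two, h0, h1] at hdet
  -- By the determinant, the lower right entry of M inverts q modulo p.
  have e : M.1 1 1 * q = 1 + p * M.1 0 1 := by linarith
  rw [← zpow_natCast, ← zpow_mul, e, zpow_add, zpow_one, zpow_mul, zpow_natCast, hη, one_zpow,
    mul_one]

/-- On the half with |y| = 1, with d the lower right entry of M, the invariants are y^p and y^(-d) ·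
x, because dq ≡ 1 modulo p. -/
theorem mk_eq_iff_inr {M : SL(2, ℤ)} {p q : ℕ} (hp : 0 < p) (h0 : M.1 0 0 = q)
    (h1 : M.1 1 0 = p) (a b : SolidTorus) :
    Quot.mk (lensRel p q) (toSphere (halves (Sum.inr a))) =
        Quot.mk (lensRel p q) (toSphere (halves (Sum.inr b))) ↔
      Quot.mk (GlueRel (linearHomeo M)) (lensCover M (Sum.inr a)) =
        Quot.mk (GlueRel (linearHomeo M)) (lensCover M (Sum.inr b)) := by
  obtain ⟨x, y⟩ := a
  obtain ⟨x', y'⟩ := b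
  rw [mk_halves_eq_iff hp]
  simp only [lensCover, Sum.map_inr, h1, zpow_natCast]
  rw [mk_inr_eq_mk_inr, Prod.mk.injEq, Subtype.ext_iff]
  change (∃ ζ : Circle, ζ ^ p = 1 ∧ (x' : ℂ) = ζ * x ∧ (y' : ℂ) = (ζ : ℂ) ^ q * y) ↔
    ((y ^ (-M.1 1 1) : Circle) : ℂ) * x = ((y' ^ (-M.1 1 1) : Circle) : ℂ) * x' ∧ _
  have key : ∀ u v : Circle, ((u : ℂ) * x = v * x' ↔ (x' : ℂ) = ((u / v : Circle) : ℂ) * x) := by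
    intro u v
    rw [Circle.coe_div, div_mul_eq_mul_div, eq_div_iff (Circle.coe_ne_zero v), mul_comm (v : ℂ),
      eq_comm]
  rw [key, zpow_neg, zpow_neg, inv_div_inv, ← div_zpow]
  constructor
  · rintro ⟨ζ, hζ, hx, hy⟩
    obtain rfl : y' = ζ ^ q * y := Circle.ext (by simpa using hy)
    have e : (ζ ^ q) ^ M.1 1 1 = ζ := by
      rw [← zpow_natCast, zpow_comm, zpow_natCast, pow_det_relation h0 h1 hζ]
    rw [mul_div_cancel_right, e, mul_pow, pow_right_comm, hζ, one_pow, one_mul]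
    exact ⟨hx, rfl⟩
  · rintro ⟨hx, hy⟩
    have hη : (y' / y) ^ p = 1 := by rw [div_pow, hy, div_self']
    -- The root of unity read off from `hx` is (y' / y)^d, with d the lower right entry of M.
    refine ⟨_, ?_, hx, ?_⟩
    · rw [← zpow_natCast, zpow_comm, zpow_natCast, hη, one_zpow]
    · rw [← Circle.coe_pow, pow_det_relation h0 h1 hη, ← Circle.coe_mul, div_mul_cancel]

/-- The gluing map applied to the image of the covering of the second solid torus. -/
theorem linearHomeo_lensCover {M : SL(2, ℤ)} {p q : ℕ} (h0 : M.1 0 0 = q) (h1 : M.1 1 0 = p)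
    (x y : Circle) :
    linearHomeo M (y ^ (-M.1 1 1) * x, y ^ p) = (x ^ q * y⁻¹, x ^ p) := by
  have hdet := M.2
  rw [Matrix.det_fin_two, h0, h1] at hdet
  rw [linearHomeo_apply, h0, h1]
  simp only [mul_zpow, ← zpow_natCast, ← zpow_mul]
  have e1 : -M.1 1 1 * q + p * M.1 0 1 = -1 := by linarith
  have e2 : -M.1 1 1 * p + p * M.1 1 1 = 0 := by ring
  refine Prod.ext ?_ ?_
  · change y ^ (-M.1 1 1 * (q : ℤ)) * x ^ (q : ℤ) * y ^ ((p : ℤ) * M.1 0 1) = _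
    rw [mul_right_comm, ← zpow_add, e1, zpow_neg_one, mul_comm]
  · change y ^ (-M.1 1 1 * (p : ℤ)) * x ^ (p : ℤ) * y ^ ((p : ℤ) * M.1 1 1) = _
    rw [mul_right_comm, ← zpow_add, e2, zpow_zero, one_mul]

theorem mk_eq_iff_inr_inl {M : SL(2, ℤ)} {p q : ℕ} (hp : 0 < p) (h0 : M.1 0 0 = q)
    (h1 : M.1 1 0 = p) (a b : SolidTorus) :
    Quot.mk (lensRel p q) (toSphere (halves (Sum.inr a))) =
        Quot.mk (lensRel p q) (toSphere (halves (Sum.inl b))) ↔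
      Quot.mk (GlueRel (linearHomeo M)) (lensCover M (Sum.inr a)) =
        Quot.mk (GlueRel (linearHomeo M)) (lensCover M (Sum.inl b)) := by
  obtain ⟨z, y⟩ := a
  obtain ⟨w, x'⟩ := b
  rw [mk_halves_eq_iff hp]
  simp only [lensCover, Sum.map_inl, Sum.map_inr, h0, h1, zpow_natCast]
  rw [mk_inr_eq_mk_inl]
  -- Either side of the equivalence forces z onto the unit circle, so both reduce to points of the
  -- common boundary torus.
  have hz : ((∃ ζ : Circle, ζ ^ p = 1 ∧ (x' : ℂ) = ζ * z ∧ (w : ℂ) = (ζ : ℂ) ^ q * y) ∨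
      ∃ X, (rotate (y ^ (-M.1 1 1)) z, y ^ p) = bdry X ∧
        (rotate (x' ^ q) (conjDisc w), x' ^ p) = bdry (linearHomeo M X)) →
      ∃ x : Circle, (z : ℂ) = x := by
    intro h
    have hn : ‖(z : ℂ)‖ = 1 := by
      rcases h with ⟨ζ, -, h, -⟩ | ⟨X, h, -⟩
      · have := congrArg norm h
        rwa [norm_mul, Circle.norm_coe, Circle.norm_coe, one_mul, eq_comm] at this
      · have := (mem_range_bdry_iff _).1 ⟨X, h⟩
        change ‖((y ^ (-M.1 1 1) : Circle) : ℂ) * (z : ℂ)‖ = 1 at this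
        rwa [norm_mul, Circle.norm_coe, one_mul] at this
    exact ⟨⟨z, mem_sphere_zero_iff_norm.2 hn⟩, rfl⟩
  have hb : ∀ x : Circle, (z : ℂ) = x →
      (rotate (y ^ (-M.1 1 1)) z, y ^ p) = bdry (y ^ (-M.1 1 1) * x, y ^ p) := fun x hx =>
    Prod.ext (Subtype.ext (by simp [rotate, bdry, hx])) rfl
  change (∃ ζ : Circle, ζ ^ p = 1 ∧ (x' : ℂ) = ζ * z ∧ (w : ℂ) = (ζ : ℂ) ^ q * y) ↔ _
  constructor
  · intro h
    obtain ⟨x, hx⟩ := hz (Or.inl h)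
    obtain ⟨ζ, hζ, hx', hw⟩ := h
    refine ⟨_, hb x hx, ?_⟩
    rw [linearHomeo_lensCover h0 h1]
    obtain rfl : x' = ζ * x := Circle.ext (by simpa [hx] using hx')
    refine Prod.ext (Subtype.ext ?_) (by simp [bdry, mul_pow, hζ])
    change (((ζ * x) ^ q : Circle) : ℂ) * starRingEnd ℂ (w : ℂ) = ((x ^ q * y⁻¹ : Circle) : ℂ)
    rw [hw, ← Circle.coe_pow, ← Circle.coe_mul, ← Circle.coe_inv_eq_conj, ← Circle.coe_mul,
      mul_pow, mul_inv, mul_comm (ζ ^ q), mul_assoc, mul_inv_cancel_left]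
  · intro h
    obtain ⟨x, hx⟩ := hz (Or.inr h)
    obtain ⟨X, hX, hX'⟩ := h
    rw [hb x hx] at hX
    rw [← bdry_injective hX, linearHomeo_lensCover h0 h1] at hX'
    have hp' : x' ^ p = x ^ p := congrArg (fun c : SolidTorus => c.2) hX'
    have hw : ((x' ^ q : Circle) : ℂ) * starRingEnd ℂ (w : ℂ) = ((x ^ q * y⁻¹ : Circle) : ℂ) :=
      congrArg (fun c : SolidTorus => (c.1 : ℂ)) hX'
    refine ⟨x' / x, by rw [div_pow, hp', div_self'], by
      rw [hx, ← Circle.coe_mul, div_mul_cancel], ?_⟩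
    have h2 := congrArg (starRingEnd ℂ) hw
    simp only [map_mul, Complex.conj_conj, ← Circle.coe_inv_eq_conj] at h2
    rw [Circle.coe_inv, inv_mul_eq_iff_eq_mul₀ (Circle.coe_ne_zero _)] at h2
    rw [h2, ← Circle.coe_pow, ← Circle.coe_mul, ← Circle.coe_mul]
    congr 1
    rw [mul_inv, inv_inv, div_pow, div_eq_mul_inv, mul_assoc]

theorem nonempty_glued_linearHomeo_homeomorph {M : SL(2, ℤ)} {p q : ℕ} (hp : 0 < p)
    (h0 : M.1 0 0 = q) (h1 : M.1 1 0 = p) :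
    Nonempty (Glued (linearHomeo M) ≃ₜ LensSpace p q) :=
  nonempty_homeomorph_of_isQuotientMap (isQuotientMap_lensCover hp h1) (isQuotientMap_halves p q)
    fun s t => (ker_sum_iff
      (f := fun s => Quot.mk (lensRel p q) (toSphere (halves s)))
      (g := fun s => Quot.mk (GlueRel (linearHomeo M)) (lensCover M s))
      (mk_eq_iff_inl hp h0 h1) (mk_eq_iff_inr hp h0 h1)
      (mk_eq_iff_inr_inl hp h0 h1) s t).symm

theorem nonempty_lensSpace_one_homeomorph : Nonempty (LensSpace 1 0 ≃ₜ Sphere3) := by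
  refine nonempty_homeomorph_of_isQuotientMap (f := Quot.mk (lensRel 1 0)) isQuotientMap_quot_mk
    (Homeomorph.refl Sphere3).isQuotientMap fun x y => ?_
  rw [(lensRel_equivalence one_pos).quot_mk_eq_iff]
  constructor
  · rintro ⟨ζ, h, h0, h1⟩
    rw [pow_one] at h
    rw [h, one_mul] at h0
    rw [pow_zero, one_mul] at h1
    apply Subtype.ext
    change x.1 = y.1
    ext i
    fin_cases i
    · exact h0.symm
    · exact h1.symm
  · intro h
    obtain rfl : x = y := h
    exact (lensRel_equivalence one_pos).refl x

/-! ### The product S¹ × S² from two hemispheres -/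

/-- The point of the 2-sphere over or under a point of the closed disc. -/
def hemisphere (ε : ℝ) (hε : ε ^ 2 = 1) (z : Metric.closedBall (0 : ℂ) 1) : Sphere2 :=
  ⟨!₂[(z : ℂ).re, (z : ℂ).im, ε * √(1 - ‖(z : ℂ)‖ ^ 2)], by
    have h1 : ‖(z : ℂ)‖ ≤ 1 := mem_closedBall_zero_iff.1 z.2
    have h2 : 0 ≤ 1 - ‖(z : ℂ)‖ ^ 2 := by
      rw [sub_nonneg, sq_le_one_iff₀ (norm_nonneg _)]
      exact h1
    rw [mem_sphere_zero_iff_norm, EuclideanSpace.norm_eq, Real.sqrt_eq_one, Fin.sum_univ_three]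
    simp only [Real.norm_eq_abs, sq_abs]
    change (z : ℂ).re ^ 2 + (z : ℂ).im ^ 2 + (ε * √(1 - ‖(z : ℂ)‖ ^ 2)) ^ 2 = 1
    rw [mul_pow, hε, Real.sq_sqrt h2, Complex.sq_norm, Complex.normSq_apply]
    ring⟩

theorem continuous_hemisphere (ε : ℝ) (hε : ε ^ 2 = 1) : Continuous (hemisphere ε hε) := by
  refine Continuous.subtype_mk ?_ _
  have h : Continuous fun z : Metric.closedBall (0 : ℂ) 1 => (z : ℂ) := continuous_subtype_val
  have h1 := Complex.continuous_re.comp h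
  have h2 := Complex.continuous_im.comp h
  have h3 : Continuous fun z : Metric.closedBall (0 : ℂ) 1 => ε * √(1 - ‖(z : ℂ)‖ ^ 2) :=
    continuous_const.mul (continuous_const.sub (h.norm.pow 2)).sqrt
  refine (PiLp.continuous_toLp 2 _).comp (continuous_pi fun i => ?_)
  fin_cases i
  · exact h1
  · exact h2
  · exact h3

theorem hemisphere_eq_iff {ε δ : ℝ} {hε : ε ^ 2 = 1} {hδ : δ ^ 2 = 1}
    {z w : Metric.closedBall (0 : ℂ) 1} :
    hemisphere ε hε z = hemisphere δ hδ w ↔ z = w ∧ (ε = δ ∨ ‖(z : ℂ)‖ = 1) := by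
  have h1 : ‖(z : ℂ)‖ ≤ 1 := mem_closedBall_zero_iff.1 z.2
  constructor
  · intro h
    have e (i : Fin 3) := congrArg (fun a : Sphere2 => a.1 i) h
    obtain rfl : z = w := Subtype.ext (Complex.ext (e 0) (e 1))
    refine ⟨rfl, ?_⟩
    have e2 : ε * √(1 - ‖(z : ℂ)‖ ^ 2) = δ * √(1 - ‖(z : ℂ)‖ ^ 2) := e 2
    rcases mul_eq_mul_right_iff.1 e2 with h | h
    · exact Or.inl h
    · right
      rw [Real.sqrt_eq_zero'] at h
      nlinarith [norm_nonneg (z : ℂ)]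
  · rintro ⟨rfl, rfl | h⟩
    · rfl
    · apply Subtype.ext
      simp [hemisphere, h]

/-- The two solid tori as the two halves of `S¹ × S²`. -/
def hemispheres : SolidTorus ⊕ SolidTorus → Circle × Sphere2 :=
  Sum.elim (fun a => (a.2, hemisphere 1 (by norm_num) a.1))
    (fun a => (a.2, hemisphere (-1) (by norm_num) a.1))

theorem continuous_hemispheres : Continuous hemispheres :=
  Continuous.sumElim
    (continuous_snd.prodMk ((continuous_hemisphere _ _).comp continuous_fst))
    (continuous_snd.prodMk ((continuous_hemisphere _ _).comp continuous_fst))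

theorem hemispheres_surjective : Function.Surjective hemispheres := by
  rintro ⟨v, ⟨x, hx⟩⟩
  have hs : x 0 ^ 2 + x 1 ^ 2 + x 2 ^ 2 = 1 := by
    rw [mem_sphere_zero_iff_norm, EuclideanSpace.norm_eq, Real.sqrt_eq_one,
      Fin.sum_univ_three] at hx
    simpa only [Real.norm_eq_abs, sq_abs] using hx
  have hn : ‖(⟨x 0, x 1⟩ : ℂ)‖ ^ 2 = 1 - x 2 ^ 2 := by
    rw [Complex.sq_norm, Complex.normSq_mk]
    linarith
  have hz : (⟨x 0, x 1⟩ : ℂ) ∈ Metric.closedBall (0 : ℂ) 1 := by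
    rw [mem_closedBall_zero_iff, ← sq_le_one_iff₀ (norm_nonneg _), hn]
    linarith [sq_nonneg (x 2)]
  have hr : √(1 - ‖(⟨x 0, x 1⟩ : ℂ)‖ ^ 2) = |x 2| := by
    rw [hn, sub_sub_cancel, Real.sqrt_sq_eq_abs]
  rcases le_total 0 (x 2) with h | h
  · refine ⟨Sum.inl (⟨_, hz⟩, v), Prod.ext rfl (Subtype.ext ?_)⟩
    change (!₂[x 0, x 1, 1 * √(1 - ‖(⟨x 0, x 1⟩ : ℂ)‖ ^ 2)] : EuclideanSpace ℝ (Fin 3)) = x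
    rw [hr, abs_of_nonneg h, one_mul]
    ext i
    fin_cases i <;> rfl
  · refine ⟨Sum.inr (⟨_, hz⟩, v), Prod.ext rfl (Subtype.ext ?_)⟩
    change (!₂[x 0, x 1, -1 * √(1 - ‖(⟨x 0, x 1⟩ : ℂ)‖ ^ 2)] : EuclideanSpace ℝ (Fin 3)) = x
    rw [hr, abs_of_nonpos h, neg_one_mul, neg_neg]
    ext i
    fin_cases i <;> rfl

/-- With the identity as gluing map, the meridian discs over each point of the circle are glued
along their boundaries into a 2-sphere; the halves meet exactly over the equator. -/
theorem nonempty_glued_one_homeomorph :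
    Nonempty (Glued (linearHomeo 1) ≃ₜ Circle × Sphere2) := by
  refine nonempty_homeomorph_of_isQuotientMap isQuotientMap_quot_mk
    (.of_surjective_continuous hemispheres_surjective continuous_hemispheres)
    (ker_sum_iff (fun a b => ?_) (fun a b => ?_) fun a b => ?_)
  · rw [mk_inl_eq_mk_inl]
    simp [hemispheres, hemisphere_eq_iff, Prod.ext_iff, and_comm]
  · rw [mk_inr_eq_mk_inr]
    simp [hemispheres, hemisphere_eq_iff, Prod.ext_iff, and_comm]
  · rw [mk_inr_eq_mk_inl, linearHomeo_one]
    have h : (-1 : ℝ) ≠ 1 := by norm_num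
    simp only [hemispheres, Sum.elim_inl, Sum.elim_inr, Prod.mk.injEq, hemisphere_eq_iff, h,
      false_or]
    rw [← mem_range_bdry_iff]
    constructor
    · rintro ⟨x, rfl, rfl⟩
      exact ⟨rfl, rfl, x, rfl⟩
    · rintro ⟨h1, h2, x, rfl⟩
      exact ⟨x, rfl, (Prod.ext h2 h1).symm⟩

end OneOneKnot

end

theorem mainTheorem5 :
    OneOneKnot.RepresentsTrivialKnot (OneOneKnot.tβ * OneOneKnot.tα * OneOneKnot.tβ) OneOneKnot.Sphere3 ∧
    OneOneKnot.RepresentsTrivialKnot 1 (Circle × OneOneKnot.Sphere2) ∧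
    ∀ (p q : ℕ) (a : List ℕ), 0 < q → q < p → Nat.Coprime p q →
      (∀ n ∈ a, 0 < n) → OneOneKnot.contFrac a = (p : ℚ) / (q : ℚ) →
        (Odd a.length → OneOneKnot.RepresentsTrivialKnot (OneOneKnot.altProd a) (OneOneKnot.LensSpace p q)) ∧
        (Even a.length →
          OneOneKnot.RepresentsTrivialKnot (OneOneKnot.altProd a * (OneOneKnot.tβ * OneOneKnot.tα * OneOneKnot.tβ)) (OneOneKnot.LensSpace p q)) := by
  refine ⟨?_, ?_, fun p q a hq hqp hpq ha hc => ?_⟩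
  -- The first column of `matS` is (0, 1), so the glued manifold is L(1, 0), the quotient of the
  -- 3-sphere by the trivial group.
  · obtain ⟨e⟩ := OneOneKnot.nonempty_glued_linearHomeo_homeomorph (M := OneOneKnot.matS)
      (p := 1) (q := 0) one_pos (by simp [OneOneKnot.matS_coe]) (by simp [OneOneKnot.matS_coe])
    obtain ⟨e'⟩ := OneOneKnot.nonempty_lensSpace_one_homeomorph
    exact OneOneKnot.representsTrivialKnot_of_mem_linearPairs OneOneKnot.matS_mem_linearPairs
      (e.trans e')
  · obtain ⟨e⟩ := OneOneKnot.nonempty_glued_one_homeomorph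
    exact OneOneKnot.representsTrivialKnot_of_mem_linearPairs (one_mem _) e
  · obtain ⟨h0, h1⟩ := OneOneKnot.altMat_column_eq hq hqp hpq ha hc
    constructor
    · intro hodd
      rw [if_pos hodd] at h0 h1
      obtain ⟨e⟩ := OneOneKnot.nonempty_glued_linearHomeo_homeomorph (hq.trans hqp) h0 h1
      exact OneOneKnot.representsTrivialKnot_of_mem_linearPairs
        (OneOneKnot.altProd_mem_linearPairs a) e
    · intro heven
      rw [if_neg (Nat.not_odd_iff_even.2 heven)] at h0 h1
      -- Right multiplication by `matS` makes the second column of `altMat a` the first.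
      have hM : (OneOneKnot.altMat a * OneOneKnot.matS).1 =
          (OneOneKnot.altMat a).1 * !![0, -1; 1, 0] := by
        rw [Matrix.SpecialLinearGroup.coe_mul, OneOneKnot.matS_coe]
      obtain ⟨e⟩ := OneOneKnot.nonempty_glued_linearHomeo_homeomorph
        (M := OneOneKnot.altMat a * OneOneKnot.matS) (hq.trans hqp)
        (by rw [hM, ← h0]; simp [Matrix.mul_apply, Fin.sum_univ_two])
        (by rw [hM, ← h1]; simp [Matrix.mul_apply, Fin.sum_univ_two])
      exact OneOneKnot.representsTrivialKnot_of_mem_linearPairs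
        (mul_mem (OneOneKnot.altProd_mem_linearPairs a) OneOneKnot.matS_mem_linearPairs) e
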